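/- Let $X$ be a connected complex surface and let $w\in H^0(X,S^2\Omega^1_X)$ be a holomorphic symmetric 2-differential of rank 2, i.e. at a general point $x$ (a point outside some proper analytic subset of $X$) $w(x)$ is a product of two linearly independent covectors. A holomorphic closed decomposition of $w$ at $x$ is an expression $w=\mu_1\mu_2$ on a neighborhood of $x$ with $\mu_1,\mu_2$ closed holomorphic 1-forms. The differential $w$ is closed if it has a holomorphic closed decomposition at a general point of $X$, and it is of the 1st kind on an open set $U\subset X$ if it has one at every $x\in U$. In a holomorphic chart $(z_1,z_2)$ write $w=E\,dz_1^2+2F\,dz_1dz_2+G\,dz_2^2$, let $\operatorname{Disc}_w$ be the divisor of zeros of the section of $2K_X$ given in each chart by $EG-F^2$, and let $\operatorname{Disc}^0_w=\operatorname{Disc}_w-2(w)_0$ be the core discriminant divisor, where $(w)_0$ is the divisor of zeros of $w$ (locally given by the greatest common divisor of $E,F,G$). Let $K_{\mathbb C}(w)$ be the meromorphic function on $X$, with poles at most along $\operatorname{Disc}_w$, given in each chart by Brioschi's formula $$K_{\mathbb C}(w)=\frac{1}{(EG-F^2)^2}\left(\begin{vmatrix}-\tfrac12E_{22}+F_{12}-\tfrac12G_{11}&\tfrac12E_1&F_1-\tfrac12E_2\\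 F_2-\tfrac12G_1&E&F\\ \tfrac12G_2&F&G\end{vmatrix}-\begin{vmatrix}0&\tfrac12E_2&\tfrac12G_1\\ \tfrac12E_2&E&F\\ \tfrac12G_1&F&G\end{vmatrix}\right),$$ where the subscripts $1,2$ of $E,F,G$ denote complex partial derivatives with respect to $z_1,z_2$. Then $w$ is closed if and only if $K_{\mathbb C}(w)=0$. Moreover, $K_{\mathbb C}(w)=0$ if and only if $w$ is of the 1st kind on $X\setminus\operatorname{Supp}(\operatorname{Disc}^0_w)$. -/

import Mathlib

open scoped Manifold ContDiff Topology

noncomputable section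

namespace ClosedDiff

/-- The model with corners of complex surfaces. A complex surface is a space `X` charted on `ℂ × ℂ`
with `IsManifold surfaceModel ω X`, i.e. with holomorphic (complex analytic) transition maps. -/
abbrev surfaceModel : ModelWithCorners ℂ (ℂ × ℂ) (ℂ × ℂ) := 𝓘(ℂ, ℂ × ℂ)

section

variable {X : Type*} [TopologicalSpace X] [ChartedSpace (ℂ × ℂ) X]

/-- The holomorphic charts of `X`. -/
abbrev HolChart (e : OpenPartialHomeomorph X (ℂ × ℂ)) : Prop :=
  e ∈ IsManifold.maximalAtlas surfaceModel ω X

/-- The tangent vector `v₁ ∂/∂z₁ + v₂ ∂/∂z₂` at the point with coordinates `z` in the chart `e`. -/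
def chartVec (e : OpenPartialHomeomorph X (ℂ × ℂ)) (z v : ℂ × ℂ) :
    TangentSpace surfaceModel (e.symm z) :=
  mfderiv surfaceModel surfaceModel e.symm z v

/-- The partial derivative `∂f/∂z₁`. -/
def partial₁ (f : ℂ × ℂ → ℂ) (z : ℂ × ℂ) : ℂ := fderiv ℂ f z (1, 0)

/-- The partial derivative `∂f/∂z₂`. -/
def partial₂ (f : ℂ × ℂ → ℂ) (z : ℂ × ℂ) : ℂ := fderiv ℂ f z (0, 1)

/-! ### Holomorphic functions, analytic subsets, general points -/

/-- `f` is holomorphic on the set `U` (used for open `U`). -/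
def HolFunOn (f : X → ℂ) (U : Set X) : Prop :=
  ContMDiffOn surfaceModel 𝓘(ℂ, ℂ) ω f U

/-- Analytic subsets: locally the common zero locus of finitely many holomorphic functions. -/
def IsAnalyticSubset (Z : Set X) : Prop :=
  ∀ x : X, ∃ U : Set X, IsOpen U ∧ x ∈ U ∧ ∃ (n : ℕ) (f : Fin n → X → ℂ),
    (∀ i, HolFunOn (f i) U) ∧ ∀ y ∈ U, (y ∈ Z ↔ ∀ i, f i y = 0)

/-- `P` holds at a general point of (the connected manifold) `X`:
it holds outside a proper analytic subset. -/
def AtGeneralPoint (P : X → Prop) : Prop :=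
  ∃ Z : Set X, IsAnalyticSubset Z ∧ Z ≠ Set.univ ∧ ∀ x, x ∉ Z → P x

end

/-! ### Holomorphic 1-forms -/

section

variable (X : Type*) [TopologicalSpace X] [ChartedSpace (ℂ × ℂ) X]

/-- A (not necessarily continuous) field of covectors of type `(1,0)`. -/
abbrev CovectorField : Type _ := ∀ x : X, Module.Dual ℂ (TangentSpace surfaceModel x)

/-- A (not necessarily continuous) field of quadratic forms on the tangent spaces,
i.e. a section of `S²` of the cotangent bundle. -/
abbrev QuadraticField : Type _ := ∀ x : X, QuadraticForm ℂ (TangentSpace surfaceModel x)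

end

section

variable {X : Type*} [TopologicalSpace X] [ChartedSpace (ℂ × ℂ) X]

/-- The coefficient of `dz₁` of a 1-form in the chart `e`. -/
def coeff₁ (μ : CovectorField X) (e : OpenPartialHomeomorph X (ℂ × ℂ)) (z : ℂ × ℂ) : ℂ :=
  μ (e.symm z) (chartVec e z (1, 0))

/-- The coefficient of `dz₂` of a 1-form in the chart `e`. -/
def coeff₂ (μ : CovectorField X) (e : OpenPartialHomeomorph X (ℂ × ℂ)) (z : ℂ × ℂ) : ℂ :=
  μ (e.symm z) (chartVec e z (0, 1))

/-- `μ` is a holomorphic 1-form on `U`: its coefficients in holomorphic charts are holomorphic. -/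
def HolFormOn (μ : CovectorField X) (U : Set X) : Prop :=
  ∀ e : OpenPartialHomeomorph X (ℂ × ℂ), HolChart e → ∀ z ∈ e.target, e.symm z ∈ U →
    AnalyticAt ℂ (coeff₁ μ e) z ∧ AnalyticAt ℂ (coeff₂ μ e) z

/-- `dμ = 0` on `U`. -/
def ClosedFormOn (μ : CovectorField X) (U : Set X) : Prop :=
  ∀ e : OpenPartialHomeomorph X (ℂ × ℂ), HolChart e → ∀ z ∈ e.target, e.symm z ∈ U →
    partial₁ (coeff₂ μ e) z = partial₂ (coeff₁ μ e) z

/-! ### Symmetric 2-differentials -/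

/-- In the chart `e`, write `q = E dz₁² + 2F dz₁dz₂ + G dz₂²`; this is `E`. -/
def coeffE (q : QuadraticField X) (e : OpenPartialHomeomorph X (ℂ × ℂ)) (z : ℂ × ℂ) : ℂ :=
  q (e.symm z) (chartVec e z (1, 0))

/-- In the chart `e`, write `q = E dz₁² + 2F dz₁dz₂ + G dz₂²`; this is `F`. -/
def coeffF (q : QuadraticField X) (e : OpenPartialHomeomorph X (ℂ × ℂ)) (z : ℂ × ℂ) : ℂ :=
  QuadraticMap.polar (q (e.symm z)) (chartVec e z (1, 0)) (chartVec e z (0, 1)) / 2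

/-- In the chart `e`, write `q = E dz₁² + 2F dz₁dz₂ + G dz₂²`; this is `G`. -/
def coeffG (q : QuadraticField X) (e : OpenPartialHomeomorph X (ℂ × ℂ)) (z : ℂ × ℂ) : ℂ :=
  q (e.symm z) (chartVec e z (0, 1))

/-- `q` is a holomorphic section of `S²Ω¹` over `U`. -/
def HolQuadOn (q : QuadraticField X) (U : Set X) : Prop :=
  ∀ e : OpenPartialHomeomorph X (ℂ × ℂ), HolChart e → ∀ z ∈ e.target, e.symm z ∈ U →
    AnalyticAt ℂ (coeffE q e) z ∧ AnalyticAt ℂ (coeffF q e) z ∧ AnalyticAt ℂ (coeffG q e) z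

end

/-- Symmetric 2-differentials on `X`: global holomorphic sections of `S²Ω¹`. -/
structure SymmetricTwoDifferential (X : Type*) [TopologicalSpace X]
    [ChartedSpace (ℂ × ℂ) X] where
  toField : QuadraticField X
  holomorphic : HolQuadOn toField Set.univ

section

variable {X : Type*} [TopologicalSpace X] [ChartedSpace (ℂ × ℂ) X]

/-- `w` has rank 2: at a general point `x` it defines two distinct lines in the tangent space,
i.e. `w(x)` is the product of two linearly independent covectors. -/
def HasRankTwo (w : SymmetricTwoDifferential X) : Prop :=
  AtGeneralPoint fun x : X => ∃ α β : Module.Dual ℂ (TangentSpace surfaceModel x),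
    LinearIndependent ℂ ![α, β] ∧ ∀ v, w.toField x v = α v * β v

/-- `w = μ₁μ₂` near `x`, with closed holomorphic 1-forms `μ₁`, `μ₂`. -/
def HasClosedDecompositionAt (w : SymmetricTwoDifferential X) (x : X) : Prop :=
  ∃ U : Set X, IsOpen U ∧ x ∈ U ∧ ∃ μ₁ μ₂ : CovectorField X,
    HolFormOn μ₁ U ∧ ClosedFormOn μ₁ U ∧ HolFormOn μ₂ U ∧ ClosedFormOn μ₂ U ∧
    ∀ y ∈ U, ∀ v, w.toField y v = μ₁ y v * μ₂ y v

/-- `w` is closed: it has a holomorphic closed decomposition at a general point. -/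
def IsClosedDifferential (w : SymmetricTwoDifferential X) : Prop :=
  AtGeneralPoint fun x => HasClosedDecompositionAt w x

/-- `w` is of the 1st kind on `U`: it has holomorphic closed decompositions at all points
of `U` (used for open `U`). -/
def IsFirstKindOn (w : SymmetricTwoDifferential X) (U : Set X) : Prop :=
  ∀ x ∈ U, HasClosedDecompositionAt w x

/-! ### Discriminant and complexified Gaussian curvature -/

/-- The discriminant `EG - F²` of `q` in the chart `e`. -/
def discr (q : QuadraticField X) (e : OpenPartialHomeomorph X (ℂ × ℂ)) (z : ℂ × ℂ) : ℂ :=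
  coeffE q e z * coeffG q e z - coeffF q e z ^ 2

end

/-- Brioschi's formula for the Gaussian curvature of `E dz₁² + 2F dz₁dz₂ + G dz₂²`,
with holomorphic `E`, `F`, `G` and complex derivatives. -/
def brioschi (E F G : ℂ × ℂ → ℂ) (z : ℂ × ℂ) : ℂ :=
  (Matrix.det !![
      - partial₂ (partial₂ E) z / 2 + partial₂ (partial₁ F) z - partial₁ (partial₁ G) z / 2,
        partial₁ E z / 2, partial₁ F z - partial₂ E z / 2;
      partial₂ F z - partial₁ G z / 2, E z, F z;
      partial₂ G z / 2, F z, G z]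
    - Matrix.det !![
      0, partial₂ E z / 2, partial₁ G z / 2;
      partial₂ E z / 2, E z, F z;
      partial₁ G z / 2, F z, G z])
  / (E z * G z - F z ^ 2) ^ 2

section

variable {X : Type*} [TopologicalSpace X] [ChartedSpace (ℂ × ℂ) X]

/-- The complexified Gaussian curvature `K_ℂ(w)` in the chart `e`. It is a meromorphic function
with poles at most along the discriminant locus, so its values are meaningful where
`discr w.toField e z ≠ 0`. -/
def complexCurvature (w : SymmetricTwoDifferential X)
    (e : OpenPartialHomeomorph X (ℂ × ℂ)) (z : ℂ × ℂ) : ℂ :=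
  brioschi (coeffE w.toField e) (coeffF w.toField e) (coeffG w.toField e) z

/-- `K_ℂ(w) = 0` as a meromorphic function on `X`: in every holomorphic chart `K_ℂ(w)` vanishes
outside the discriminant locus. -/
def ComplexCurvatureVanishes (w : SymmetricTwoDifferential X) : Prop :=
  ∀ e : OpenPartialHomeomorph X (ℂ × ℂ), HolChart e → ∀ z ∈ e.target,
    discr w.toField e z ≠ 0 → complexCurvature w e z = 0

/-! ### The core discriminant divisor

Divisors on a manifold are described by their local equations, which are germs of holomorphic
functions, well defined up to units. -/

/-- `f` is holomorphic at (hence near) `x`. -/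
def HolFunAt (f : X → ℂ) (x : X) : Prop :=
  ContMDiffAt surfaceModel 𝓘(ℂ, ℂ) ω f x

/-- The germ at `x` of the holomorphic function `h` divides the germ of `w`:
`w = h ŵ` near `x`, with a holomorphic symmetric 2-differential `ŵ` near `x`. -/
def DividesAt (h : X → ℂ) (w : SymmetricTwoDifferential X) (x : X) : Prop :=
  ∃ U : Set X, IsOpen U ∧ x ∈ U ∧ HolFunOn h U ∧ ∃ q : QuadraticField X, HolQuadOn q U ∧
    ∀ y ∈ U, ∀ v, w.toField y v = h y * q y v

/-- `h` is a local equation at `x` of the divisor of zeros `(w)₀` of `w`: it is the greatest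
common divisor of (the coefficients of) `w` in the ring of germs of holomorphic functions. -/
def IsZeroDivisorEquation (w : SymmetricTwoDifferential X) (x : X) (h : X → ℂ) : Prop :=
  DividesAt h w x ∧ ∀ h' : X → ℂ, DividesAt h' w x →
    ∃ k : X → ℂ, HolFunAt k x ∧ ∀ᶠ y in 𝓝 x, h y = k y * h' y

/-- `δ` is a local equation at `x` of the core discriminant divisor `Disc⁰_w = Disc_w - 2 (w)₀`:
the discriminant of `w` is `δ h²`, with a local equation `h` of `(w)₀`. -/
def IsCoreDiscrEquation (w : SymmetricTwoDifferential X) (x : X) (δ : X → ℂ) : Prop :=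
  HolFunAt δ x ∧ ∃ h : X → ℂ, IsZeroDivisorEquation w x h ∧
    ∃ e : OpenPartialHomeomorph X (ℂ × ℂ), HolChart e ∧ x ∈ e.source ∧
      ∀ᶠ y in 𝓝 x, discr w.toField e (e y) = δ y * h y ^ 2

/-- The support of the core discriminant divisor: the points at which its local equations
vanish. -/
def coreDiscrSupport (w : SymmetricTwoDifferential X) : Set X :=
  {x | ∀ δ : X → ℂ, IsCoreDiscrEquation w x δ → δ x = 0}

end

end ClosedDiff

end

noncomputable section

namespace ClosedDiff

open Metric Complex

/-! ### Osgood's lemma on `ℂ × ℂ` -/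

/-! One direction is computation plus density. If `w = μ₁μ₂` near a point with both factors closed,
substituting `dμᵢ = 0` makes the numerator of Brioschi's formula cancel identically
(`brioschi_eq_zero`). A closed differential has such decompositions off a proper analytic subset,
whose complement is dense by the identity theorem (`IsAnalyticSubset.dense_compl`). Since the
curvature is continuous where the discriminant is nonzero, it vanishes there.

For the converse, take `x` outside the core discriminant. Then `w = h q` near `x` with `q`
nondegenerate at `x`, although `h`, and so `w`, may vanish there. The two isotropic line fields of
`q` are holomorphic and distinct, and their first integrals are local coordinates
(`exists_null_coordinates`) in which `q`, hence `w`, has no `dz₁²` and no `dz₂²` term. For `w = 2F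
dz₁dz₂`, zero curvature means `F F₁₂ = F₁F₂` where `F ≠ 0`, that is, `∂₁∂₂ log F = 0`
(`brioschi_of_null`). So `F` splits as `A(z₁)B(z₂)` near a point where it is nonzero, and the
identity theorem spreads the splitting over a whole polydisc, across the zeros of `F`
(`exists_eq_mul_of_partial`). Then `w = (2A dz₁)(B dz₂)` with closed factors. The remaining
implications follow because nondegenerate points are general and lie outside the core discriminant
(`NondegenerateAt.notMem_coreDiscrSupport`).

The analytic input is `exists_firstIntegral`: the first integral is a Lie series `∑ (-s)ⁿ/n! · vⁿf`,
which converges by Cauchy's estimates. Its sum is jointly analytic by Osgood's lemma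
`analyticAt_of_separately`. -/

/-- Integration of continuous functions over the circle. -/
def circleFunctional : C(Circle, ℂ) →L[ℂ] ℂ :=
  LinearMap.mkContinuous
    { toFun := fun g => ∫ θ in (0 : ℝ)..2 * Real.pi, g (Circle.exp θ)
      map_add' := fun g h => by
        simp only [ContinuousMap.add_apply]
        refine intervalIntegral.integral_add ?_ ?_ <;>
          exact Continuous.intervalIntegrable (by fun_prop) _ _
      map_smul' := fun a g => by
        simp only [ContinuousMap.smul_apply, RingHom.id_apply]
        exact intervalIntegral.integral_smul _ _ }
    (|2 * Real.pi - 0|) (fun g => by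
      refine le_of_le_of_eq ?_ (mul_comm _ _)
      exact intervalIntegral.norm_integral_le_of_norm_le_const fun θ _ => g.norm_coe_le_norm _)

lemma circleFunctional_apply (g : C(Circle, ℂ)) :
    circleFunctional g = ∫ θ in (0 : ℝ)..2 * Real.pi, g (Circle.exp θ) := rfl

/-- The continuous function `ζ ↦ rζ` on the circle. -/
def circleScale (r : ℝ) : C(Circle, ℂ) := ⟨fun ζ => (r : ℂ) * ζ, by fun_prop⟩

/-- This makes the Cauchy denominator invertible in the Banach algebra `C(Circle, ℂ)` at the centre
of the disc, hence also nearby. -/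
lemma isUnit_circleScale {r : ℝ} (hr : 0 < r) : IsUnit (circleScale r) := by
  refine IsUnit.of_mul_eq_one ⟨fun ζ => ((r : ℂ) * ζ)⁻¹, ?_⟩ ?_
  · refine Continuous.inv₀ (by fun_prop) fun ζ => ?_
    simp [hr.ne']
  · ext ζ
    have : (r : ℂ) * (ζ : ℂ) ≠ 0 := by simp [hr.ne']
    simp only [circleScale, ContinuousMap.mul_apply, ContinuousMap.coe_mk, ContinuousMap.one_apply]
    exact mul_inv_cancel₀ this

/-- The function with values in continuous functions on a circle given by `f (x, ·)`. -/
def circleSlice (f : ℂ × ℂ → ℂ) (c : ℂ) (r : ℝ) (x : ℂ) : C(Circle, ℂ) :=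
  open Classical in
  if h : Continuous fun ζ : Circle => f (x, c + r * ζ) then ⟨_, h⟩ else 0

lemma mem_closedBall_circle {c : ℂ} {r : ℝ} (hr : 0 < r) (ζ : Circle) :
    c + r * (ζ : ℂ) ∈ closedBall c r := by
  simp [abs_of_pos hr, Circle.norm_coe]

lemma circleSlice_apply {f : ℂ × ℂ → ℂ} {z₀ : ℂ × ℂ} {r : ℝ} (hr : 0 < r)
    (hf : ContinuousOn f (closedBall z₀ r)) {x : ℂ} (hx : x ∈ closedBall z₀.1 r) (ζ : Circle) :
    circleSlice f z₀.2 r x ζ = f (x, z₀.2 + r * ζ) := by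
  have : Continuous fun ζ : Circle => f (x, z₀.2 + r * ζ) := by
    refine hf.comp_continuous (by fun_prop) fun ζ => ?_
    rw [← closedBall_prod_same]
    exact ⟨hx, mem_closedBall_circle hr ζ⟩
  rw [circleSlice, dif_pos this]
  rfl

lemma continuousOn_circleSlice {f : ℂ × ℂ → ℂ} {z₀ : ℂ × ℂ} {r : ℝ} (hr : 0 < r)
    (hf : ContinuousOn f (closedBall z₀ r)) :
    ContinuousOn (circleSlice f z₀.2 r) (closedBall z₀.1 r) := by
  rw [continuousOn_iff_continuous_domRestrict]
  refine ContinuousMap.continuous_of_continuous_uncurry _ ?_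
  have : (Function.uncurry fun (x : closedBall z₀.1 r) (ζ : Circle) =>
      ((closedBall z₀.1 r).domRestrict (circleSlice f z₀.2 r) x) ζ)
      = fun p : closedBall z₀.1 r × Circle => f ((p.1 : ℂ), z₀.2 + r * (p.2 : ℂ)) := by
    ext ⟨x, ζ⟩
    exact circleSlice_apply hr hf x.2 ζ
  rw [this]
  refine hf.comp_continuous (by fun_prop) fun p => ?_
  rw [← closedBall_prod_same]
  exact ⟨p.1.2, mem_closedBall_circle hr p.2⟩

/-- **Osgood's lemma**: a continuous function which is holomorphic in each variable separately
is analytic. -/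
theorem analyticAt_of_separately {f : ℂ × ℂ → ℂ} {z₀ : ℂ × ℂ} {R : ℝ} (hR : 0 < R)
    (hf : ContinuousOn f (ball z₀ R))
    (h₁ : ∀ z ∈ ball z₀ R, DifferentiableAt ℂ (fun x => f (x, z.2)) z.1)
    (h₂ : ∀ z ∈ ball z₀ R, DifferentiableAt ℂ (fun y => f (z.1, y)) z.2) :
    AnalyticAt ℂ f z₀ := by
  obtain ⟨r, hr, hrR⟩ : ∃ r, 0 < r ∧ r < R := exists_between hR
  have hsub : closedBall z₀ r ⊆ ball z₀ R := closedBall_subset_ball hrR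
  have hfc := hf.mono hsub
  have mem : ∀ {x y}, x ∈ closedBall z₀.1 r → y ∈ closedBall z₀.2 r → (x, y) ∈ ball z₀ R := by
    intro x y hx hy
    apply hsub
    rw [← closedBall_prod_same]
    exact ⟨hx, hy⟩
  set G := circleSlice f z₀.2 r with hG
  have hGc := continuousOn_circleSlice hr hfc
  -- Cauchy's integral in the first variable, with values in the Banach space `C(Circle, ℂ)`. It is
  -- analytic in `w` as a vector-valued function, uniformly over the circle in the second variable.
  set H : ℂ → C(Circle, ℂ) :=
    fun w => (2 * ↑Real.pi * I)⁻¹ • ∮ (z : ℂ) in C(z₀.1, r), (z - w)⁻¹ • G z with hH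
  have hHan : AnalyticAt ℂ H z₀.1 := by
    have hI : CircleIntegrable G z₀.1 ((⟨r, hr.le⟩ : NNReal) : ℝ) :=
      (hGc.mono sphere_subset_closedBall).circleIntegrable hr.le
    exact (hasFPowerSeriesOn_cauchy_integral hI hr).analyticAt
  have hHval : ∀ x ∈ ball z₀.1 r, ∀ ζ : Circle, H x ζ = f (x, z₀.2 + r * ζ) := by
    intro x hx ζ
    have hη := mem_closedBall_circle (c := z₀.2) hr ζ
    have key : (∮ (z : ℂ) in C(z₀.1, r), (z - x)⁻¹ • G z) ζ
        = ∮ (z : ℂ) in C(z₀.1, r), (z - x)⁻¹ • f (z, z₀.2 + r * ζ) := by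
      have hint : CircleIntegrable (fun z => (z - x)⁻¹ • G z) z₀.1 r := by
        refine ContinuousOn.circleIntegrable hr.le (ContinuousOn.fun_smul ?_
          (hGc.mono sphere_subset_closedBall))
        refine ContinuousOn.inv₀ (by fun_prop) fun z hz h => ?_
        rw [sub_eq_zero] at h
        subst h
        exact absurd (mem_ball.1 hx) (by rw [mem_sphere.1 hz]; exact lt_irrefl r)
      have h1 := ContinuousLinearMap.intervalIntegral_comp_comm
        (ContinuousMap.evalCLM ℂ ζ : C(Circle, ℂ) →L[ℂ] ℂ) hint.out
      have h2 : (∮ (z : ℂ) in C(z₀.1, r), (z - x)⁻¹ • G z) ζ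
        = ∮ (z : ℂ) in C(z₀.1, r), (z - x)⁻¹ • G z ζ := h1.symm
      rw [h2]
      refine circleIntegral.integral_congr hr.le fun z hz => ?_
      simp only [hG]
      rw [circleSlice_apply hr hfc (sphere_subset_closedBall hz)]
    have hd : DiffContOnCl ℂ (fun z => f (z, z₀.2 + r * ζ)) (ball z₀.1 r) := by
      refine DifferentiableOn.diffContOnCl fun z hz => ?_
      rw [closure_ball _ hr.ne'] at hz
      exact (h₁ (z, z₀.2 + r * ζ) (mem hz hη)).differentiableWithinAt
    have := hd.circleIntegral_sub_inv_smul hx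
    simp only [hH, ContinuousMap.smul_apply, key, this]
    rw [smul_smul, inv_mul_cancel₀ Complex.two_pi_I_ne_zero, one_smul]
  -- The denominator `z₀.2 + rζ - y` of Cauchy's kernel in the second variable, as an affine
  -- function of `y` with values in the Banach algebra. Inversion is analytic on units.
  set A : ℂ → C(Circle, ℂ) := fun y => circleScale r + (z₀.2 - y) • (1 : C(Circle, ℂ)) with hA
  have hAan : AnalyticAt ℂ A z₀.2 := by
    refine analyticAt_const.fun_add (AnalyticAt.fun_smul ?_ analyticAt_const)
    exact analyticAt_const.fun_sub analyticAt_id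
  have hA0 : A z₀.2 = circleScale r := by simp [hA]
  obtain ⟨u, hu⟩ := isUnit_circleScale hr
  have hunit : ∀ᶠ y in 𝓝 z₀.2, IsUnit (A y) := by
    refine hAan.continuousAt.eventually (Units.isOpen.mem_nhds ?_)
    rw [hA0]
    exact isUnit_circleScale hr
  have hInv : AnalyticAt ℂ (fun y => Ring.inverse (A y)) z₀.2 := by
    refine AnalyticAt.fun_comp (g := Ring.inverse) ?_ hAan
    rw [hA0, ← hu]
    exact analyticAt_inverse u
  -- Cauchy's formula in the second variable, written as a continuous functional of analytic
  -- Banach-valued functions of `z.1` and `z.2`. The factor `rζ` comes from the derivative of the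
  -- circle parametrization, and its `I` cancels the one in `2πI`.
  have hP : AnalyticAt ℂ (fun z : ℂ × ℂ => (2 * (Real.pi : ℂ))⁻¹ * circleFunctional
      ((circleScale r * Ring.inverse (A z.2)) * H z.1)) z₀ := by
    refine analyticAt_const.fun_mul ?_
    refine (circleFunctional.analyticAt _).fun_comp ?_
    refine AnalyticAt.fun_mul (analyticAt_const.fun_mul ?_) ?_
    · exact AnalyticAt.fun_comp (g := fun y => Ring.inverse (A y)) hInv analyticAt_snd
    · exact AnalyticAt.fun_comp (g := H) hHan analyticAt_fst
  refine hP.congr ?_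
  have e1 : ∀ᶠ z : ℂ × ℂ in 𝓝 z₀, z ∈ ball z₀ r := ball_mem_nhds _ hr
  have e2 : ∀ᶠ z : ℂ × ℂ in 𝓝 z₀, IsUnit (A z.2) := continuousAt_snd.eventually hunit
  filter_upwards [e1, e2] with z hz hzu
  rw [← ball_prod_same] at hz
  have hd : DiffContOnCl ℂ (fun y => f (z.1, y)) (ball z₀.2 r) := by
    refine DifferentiableOn.diffContOnCl fun y hy => ?_
    rw [closure_ball _ hr.ne'] at hy
    exact (h₂ (z.1, y) (mem (ball_subset_closedBall hz.1) hy)).differentiableWithinAt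
  have hc := hd.circleIntegral_sub_inv_smul hz.2
  have hval : ∀ ζ : Circle, Ring.inverse (A z.2) ζ = (z₀.2 + r * ζ - z.2)⁻¹ := by
    intro ζ
    have := congrArg (fun g : C(Circle, ℂ) => g ζ) (Ring.mul_inverse_cancel _ hzu)
    simp only [ContinuousMap.mul_apply, ContinuousMap.one_apply] at this
    rw [eq_inv_of_mul_eq_one_right this]
    congr 1
    simp [hA, circleScale]
    ring
  have hI : ∮ (y : ℂ) in C(z₀.2, r), (y - z.2)⁻¹ • f (z.1, y) = I * circleFunctional
      ((circleScale r * Ring.inverse (A z.2)) * H z.1) := by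
    rw [circleFunctional_apply, circleIntegral, ← intervalIntegral.integral_const_mul]
    congr 1
    ext θ
    simp only [ContinuousMap.mul_apply, hval, hHval _ hz.1, deriv_circleMap, circleMap,
      circleScale, ContinuousMap.coe_mk, Circle.coe_exp, smul_eq_mul]
    ring
  rw [hI] at hc
  have : (z.1, z.2) = z := rfl
  simp only [smul_eq_mul, this] at hc
  have hpi : (Real.pi : ℂ) ≠ 0 := by exact_mod_cast Real.pi_ne_zero
  field_simp
  have := mul_left_cancel₀ I_ne_zero (hc.trans (by ring :
    2 * (Real.pi : ℂ) * I * f z = I * (2 * Real.pi * f z)))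
  exact this

end ClosedDiff
end

noncomputable section

namespace ClosedDiff

open Metric Complex

/-! ### First integrals of holomorphic vector fields -/

/-- The derivative of a function along a vector field. -/
def lieDeriv (v : ℂ × ℂ → ℂ × ℂ) (g : ℂ × ℂ → ℂ) (z : ℂ × ℂ) : ℂ := fderiv ℂ g z (v z)

lemma analyticOnNhd_lieDeriv {v : ℂ × ℂ → ℂ × ℂ} {g : ℂ × ℂ → ℂ} {s : Set (ℂ × ℂ)}
    (hv : AnalyticOnNhd ℂ v s) (hg : AnalyticOnNhd ℂ g s) :
    AnalyticOnNhd ℂ (lieDeriv v g) s :=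
  fun z hz => ((ContinuousLinearMap.id ℂ (ℂ × ℂ →L[ℂ] ℂ)).analyticAt_bilinear
    (fderiv ℂ g z, v z)).comp_of_eq ((hg z hz).fderiv.prod (hv z hz)) rfl

lemma hasDerivAt_comp_line {g : ℂ × ℂ → ℂ} {z a : ℂ × ℂ} (hg : DifferentiableAt ℂ g z) :
    HasDerivAt (fun t : ℂ => g (z + t • a)) (fderiv ℂ g z a) 0 := by
  have h1 : HasDerivAt (fun t : ℂ => z + t • a) a 0 := by
    simpa using ((hasDerivAt_id (0 : ℂ)).smul_const a).const_add z
  have h2 : HasFDerivAt g (fderiv ℂ g z) (z + (0 : ℂ) • a) := by simpa using hg.hasFDerivAt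
  exact h2.comp_hasDerivAt (0 : ℂ) h1

/-- Cauchy's estimate for directional derivatives. -/
lemma norm_fderiv_apply_le {g : ℂ × ℂ → ℂ} {z₀ z a : ℂ × ℂ} {ρ ρ' C M : ℝ}
    (hg : AnalyticOnNhd ℂ g (ball z₀ ρ)) (hC : ∀ y ∈ ball z₀ ρ, ‖g y‖ ≤ C) (hρ : ρ' < ρ)
    (hz : z ∈ ball z₀ ρ') (hM : 0 < M) (ha : ‖a‖ ≤ M) :
    ‖fderiv ℂ g z a‖ ≤ C / ((ρ - ρ') / M) := by
  have hs : 0 < (ρ - ρ') / M := div_pos (sub_pos.2 hρ) hM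
  have mem : ∀ t ∈ closedBall (0 : ℂ) ((ρ - ρ') / M), z + t • a ∈ ball z₀ ρ := by
    intro t ht
    rw [mem_closedBall_zero_iff] at ht
    rw [mem_ball, dist_eq_norm] at hz ⊢
    have h1 : ‖t • a‖ ≤ ρ - ρ' := by
      rw [norm_smul]
      calc ‖t‖ * ‖a‖ ≤ (ρ - ρ') / M * M := by gcongr
        _ = ρ - ρ' := by field_simp
    calc ‖z + t • a - z₀‖ = ‖(z - z₀) + t • a‖ := by congr 1; abel
      _ ≤ ‖z - z₀‖ + ‖t • a‖ := norm_add_le _ _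
      _ < ρ := by linarith
  have hz' : z ∈ ball z₀ ρ := ball_subset_ball hρ.le hz
  rw [← (hasDerivAt_comp_line (hg z hz').differentiableAt).deriv]
  refine norm_deriv_le_of_forall_mem_sphere_norm_le hs ?_
    fun t ht => hC _ (mem t (sphere_subset_closedBall ht))
  refine DifferentiableOn.diffContOnCl fun t ht => ?_
  rw [closure_ball _ hs.ne'] at ht
  have : DifferentiableAt ℂ g (z + t • a) := (hg _ (mem t ht)).differentiableAt
  exact (this.comp t (by fun_prop : DifferentiableAt ℂ (fun t : ℂ => z + t • a) t)
    ).differentiableWithinAt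

lemma analyticOnNhd_lieDeriv_iterate {v : ℂ × ℂ → ℂ × ℂ} {g : ℂ × ℂ → ℂ} {s : Set (ℂ × ℂ)}
    (hv : AnalyticOnNhd ℂ v s) (hg : AnalyticOnNhd ℂ g s) (n : ℕ) :
    AnalyticOnNhd ℂ ((lieDeriv v)^[n] g) s := by
  induction n with
  | zero => exact hg
  | succ n ih =>
    rw [Function.iterate_succ_apply']
    exact analyticOnNhd_lieDeriv hv ih

/-- Descend from radius `2r` to radius `r` in `n` equal steps, applying Cauchy's estimate once per
step. Each step costs a factor `M n / r`, and `nⁿ ≤ eⁿ n!` turns the product into a bound that the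
`n!` of a Lie series absorbs. -/
lemma norm_lieDeriv_iterate_le {v : ℂ × ℂ → ℂ × ℂ} {g : ℂ × ℂ → ℂ} {z₀ : ℂ × ℂ} {r C M : ℝ}
    (hr : 0 < r) (hM : 0 < M) (hC : 0 ≤ C) (hv : AnalyticOnNhd ℂ v (ball z₀ (2 * r)))
    (hg : AnalyticOnNhd ℂ g (ball z₀ (2 * r))) (hgC : ∀ y ∈ ball z₀ (2 * r), ‖g y‖ ≤ C)
    (hvM : ∀ y ∈ ball z₀ (2 * r), ‖v y‖ ≤ M) (n : ℕ) {z : ℂ × ℂ} (hz : z ∈ ball z₀ r) :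
    ‖(lieDeriv v)^[n] g z‖ ≤ C * (M / r * Real.exp 1) ^ n * n.factorial := by
  rcases Nat.eq_zero_or_pos n with rfl | hn
  · simpa using hgC z (ball_subset_ball (by linarith) hz)
  have hn' : (0 : ℝ) < n := by exact_mod_cast hn
  have key : ∀ k : ℕ, k ≤ n → ∀ z ∈ ball z₀ (2 * r - k * (r / n)),
      ‖(lieDeriv v)^[k] g z‖ ≤ C * (M / r * n) ^ k := by
    intro k
    induction k with
    | zero =>
      intro _ z hz
      simpa using hgC z (by simpa using hz)
    | succ k ih =>
      intro hk z hz
      rw [Function.iterate_succ_apply']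
      have hlt : 2 * r - ((k + 1 : ℕ) : ℝ) * (r / n) < 2 * r - k * (r / n) := by
        push_cast
        have : 0 < r / n := by positivity
        linarith
      have hsub : ball z₀ (2 * r - k * (r / n)) ⊆ ball z₀ (2 * r) :=
        ball_subset_ball (by have : 0 ≤ k * (r / n) := by positivity
                             linarith)
      refine (norm_fderiv_apply_le ((analyticOnNhd_lieDeriv_iterate hv hg k).mono hsub)
        (ih (by omega)) hlt hz hM (hvM z (hsub (ball_subset_ball hlt.le hz)))).trans_eq ?_
      have h1 : 2 * r - k * (r / n) - (2 * r - ((k + 1 : ℕ) : ℝ) * (r / n)) = r / n := by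
        push_cast
        ring
      rw [h1, pow_succ]
      field_simp
  have hz' : z ∈ ball z₀ (2 * r - n * (r / n)) := by
    have : 2 * r - n * (r / n) = r := by field_simp; ring
    rwa [this]
  refine (key n le_rfl z hz').trans ?_
  have h2 := Real.pow_div_factorial_le_exp (n : ℝ) hn'.le n
  rw [div_le_iff₀ (by positivity)] at h2
  have h3 : Real.exp (n : ℝ) = Real.exp 1 ^ n := by rw [← Real.exp_nat_mul, mul_one]
  rw [h3] at h2
  calc C * (M / r * n) ^ n = C * (M / r) ^ n * (n : ℝ) ^ n := by rw [mul_pow]; ring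
    _ ≤ C * (M / r) ^ n * (Real.exp 1 ^ n * n.factorial) := by gcongr
    _ = _ := by rw [mul_pow]; ring

/-- A function series of analytic functions on a ball of `ℂ × ℂ` dominated by a summable series
has an analytic sum. -/
lemma analyticOnNhd_tsum {F : ℕ → ℂ × ℂ → ℂ} {z₀ : ℂ × ℂ} {δ : ℝ} {c : ℕ → ℝ} (hc : Summable c)
    (hF : ∀ n, AnalyticOnNhd ℂ (F n) (ball z₀ δ)) (hb : ∀ n, ∀ z ∈ ball z₀ δ, ‖F n z‖ ≤ c n) :
    AnalyticOnNhd ℂ (fun z => ∑' n, F n z) (ball z₀ δ) := by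
  intro z hz
  obtain ⟨ε, hε, hsub⟩ := isOpen_iff.1 isOpen_ball z hz
  -- The sum is continuous by uniform convergence, and holomorphic in each variable by the
  -- one-variable Weierstrass theorem.
  refine analyticAt_of_separately hε
    ((continuousOn_tsum (fun n => (hF n).continuousOn) hc hb).mono hsub) ?_ ?_
  · intro y hy
    have ho : IsOpen {x : ℂ | (x, y.2) ∈ ball z₀ δ} := isOpen_ball.preimage (by fun_prop)
    refine (differentiableOn_tsum_of_summable_norm (F := fun n x => F n (x, y.2)) hc ?_ ho
      fun n x hx => hb n _ hx).differentiableAt (ho.mem_nhds (hsub hy))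
    intro n x hx
    have : DifferentiableAt ℂ (F n) (x, y.2) := (hF n _ hx).differentiableAt
    exact (this.comp x (by fun_prop : DifferentiableAt ℂ (fun x => (x, y.2)) x)
      ).differentiableWithinAt
  · intro y hy
    have ho : IsOpen {x : ℂ | (y.1, x) ∈ ball z₀ δ} := isOpen_ball.preimage (by fun_prop)
    refine (differentiableOn_tsum_of_summable_norm (F := fun n x => F n (y.1, x)) hc ?_ ho
      fun n x hx => hb n _ hx).differentiableAt (ho.mem_nhds (hsub hy))
    intro n x hx
    have : DifferentiableAt ℂ (F n) (y.1, x) := (hF n _ hx).differentiableAt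
    exact (this.comp x (by fun_prop : DifferentiableAt ℂ (fun x => (y.1, x)) x)
      ).differentiableWithinAt

/-- Termwise differentiation of a dominated series of analytic functions. -/
lemma hasSum_fderiv_apply {F : ℕ → ℂ × ℂ → ℂ} {z₀ : ℂ × ℂ} {δ : ℝ} {c : ℕ → ℝ} (hc : Summable c)
    (hF : ∀ n, AnalyticOnNhd ℂ (F n) (ball z₀ δ)) (hb : ∀ n, ∀ z ∈ ball z₀ δ, ‖F n z‖ ≤ c n)
    {z : ℂ × ℂ} (hz : z ∈ ball z₀ δ) (a : ℂ × ℂ) :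
    HasSum (fun n => fderiv ℂ (F n) z a) (fderiv ℂ (fun z => ∑' n, F n z) z a) := by
  have ho : IsOpen {t : ℂ | z + t • a ∈ ball z₀ δ} := isOpen_ball.preimage (by fun_prop)
  have h := hasSum_deriv_of_summable_norm (F := fun n t => F n (z + t • a)) (z := 0) hc
    ?_ ho (fun n t ht => hb n _ ht) (by simpa using hz)
  · rw [(hasDerivAt_comp_line (analyticOnNhd_tsum hc hF hb z hz).differentiableAt).deriv] at h
    have e : (fun n => fderiv ℂ (F n) z a) = fun n => deriv (fun t : ℂ => F n (z + t • a)) 0 :=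
      funext fun n => (hasDerivAt_comp_line (hF n z hz).differentiableAt).deriv.symm
    rwa [e]
  · intro n t ht
    have : DifferentiableAt ℂ (F n) (z + t • a) := (hF n _ ht).differentiableAt
    exact (this.comp t (by fun_prop : DifferentiableAt ℂ (fun t : ℂ => z + t • a) t)
      ).differentiableWithinAt

/-- Existence of first integrals: a holomorphic vector field `v` transversal to the fibres of the
linear function `ℓ` has a first integral which has the same derivative along the fibre as a given
linear function `f`. -/
theorem exists_firstIntegral {v : ℂ × ℂ → ℂ × ℂ} {z₀ : ℂ × ℂ} (hv : AnalyticAt ℂ v z₀)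
    (ℓ f : ℂ × ℂ →L[ℂ] ℂ) (hℓ : ∀ z, ℓ (v z) = 1) :
    ∃ u : ℂ × ℂ → ℂ, AnalyticAt ℂ u z₀ ∧ (∀ᶠ z in 𝓝 z₀, fderiv ℂ u z (v z) = 0) ∧
      ∀ a, ℓ a = 0 → fderiv ℂ u z₀ a = f a := by
  obtain ⟨r, C, M, hr, hM, hC, hvan, hgC, hvM⟩ : ∃ r C M : ℝ, 0 < r ∧ 0 < M ∧ 0 ≤ C ∧
      AnalyticOnNhd ℂ v (ball z₀ (2 * r)) ∧ (∀ y ∈ ball z₀ (2 * r), ‖f y‖ ≤ C) ∧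
      ∀ y ∈ ball z₀ (2 * r), ‖v y‖ ≤ M := by
    have h1 : ∀ᶠ z in 𝓝 z₀, ‖f z‖ ≤ ‖f z₀‖ + 1 :=
      (f.continuous.norm.continuousAt.eventually_lt continuousAt_const
        (by simp : ‖f z₀‖ < ‖f z₀‖ + 1)).mono fun _ h => h.le
    have h2 : ∀ᶠ z in 𝓝 z₀, ‖v z‖ ≤ ‖v z₀‖ + 1 :=
      (hv.continuousAt.norm.eventually_lt continuousAt_const
        (by simp : ‖v z₀‖ < ‖v z₀‖ + 1)).mono fun _ h => h.le
    obtain ⟨ε, hε, h⟩ := eventually_nhds_iff_ball.1 (hv.eventually_analyticAt.and (h1.and h2))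
    have e : 2 * (ε / 2) = ε := by ring
    refine ⟨ε / 2, ‖f z₀‖ + 1, ‖v z₀‖ + 1, by positivity, by positivity, by positivity, ?_⟩
    rw [e]
    exact ⟨fun z hz => (h z hz).1, fun z hz => (h z hz).2.1, fun z hz => (h z hz).2.2⟩
  have hfan : AnalyticOnNhd ℂ f (ball z₀ (2 * r)) := fun z _ => f.analyticAt z
  set W : ℕ → ℂ × ℂ → ℂ := fun n => (lieDeriv v)^[n] f with hW
  have hWan : ∀ n, AnalyticOnNhd ℂ (W n) (ball z₀ (2 * r)) :=
    analyticOnNhd_lieDeriv_iterate hvan hfan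
  have hWb : ∀ n, ∀ z ∈ ball z₀ r, ‖W n z‖ ≤ C * (M / r * Real.exp 1) ^ n * n.factorial :=
    fun n z hz => norm_lieDeriv_iterate_le hr hM hC hvan hfan hgC hvM n hz
  set K : ℝ := M / r * Real.exp 1 with hK
  have hKpos : 0 < K := by positivity
  clear_value K
  -- The radius is chosen so that `K * ‖ℓ (z - z₀)‖ ≤ 1 / 2`, which dominates the Lie series by a
  -- geometric series of ratio `1/2`.
  set δ : ℝ := min r (1 / (2 * K * (‖ℓ‖ + 1))) with hδ
  have hδpos : 0 < δ := lt_min hr (by positivity)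
  have hδK : K * ((‖ℓ‖ + 1) * δ) ≤ 1 / 2 := by
    calc K * ((‖ℓ‖ + 1) * δ) ≤ K * ((‖ℓ‖ + 1) * (1 / (2 * K * (‖ℓ‖ + 1)))) := by
          gcongr
          exact min_le_right _ _
      _ = 1 / 2 := by field_simp
  have hsub : ball z₀ δ ⊆ ball z₀ r := ball_subset_ball (min_le_left _ _)
  have hsub' : ball z₀ δ ⊆ ball z₀ (2 * r) := hsub.trans (ball_subset_ball (by linarith))
  have hs : ∀ z ∈ ball z₀ δ, K * ‖-ℓ (z - z₀)‖ ≤ 1 / 2 := by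
    intro z hz
    refine le_trans ?_ hδK
    rw [norm_neg]
    gcongr
    refine (ℓ.le_opNorm _).trans ?_
    rw [mem_ball, dist_eq_norm] at hz
    gcongr
    linarith
  have hcoef : ∀ m n : ℕ, ∀ z ∈ ball z₀ δ, ‖(-ℓ (z - z₀)) ^ n / (n.factorial : ℂ) * W m z‖
      ≤ ‖-ℓ (z - z₀)‖ ^ n / n.factorial * (C * K ^ m * m.factorial) := by
    intro m n z hz
    rw [norm_mul, norm_div, norm_pow, Complex.norm_natCast]
    gcongr
    exact hWb m z (hsub hz)
  -- With `s = ℓ (z - z₀)`, the sum of `(-s)ⁿ/n! · vⁿf` is formally `f` transported along the flow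
  -- of `v` for time `-s`, back to the slice `s = 0`. It should thus be constant on integral curves.
  set F : ℕ → ℂ × ℂ → ℂ := fun n z => (-ℓ (z - z₀)) ^ n / (n.factorial : ℂ) * W n z with hF
  have hFan : ∀ n, AnalyticOnNhd ℂ (F n) (ball z₀ δ) := by
    intro n z hz
    have h1 : AnalyticAt ℂ (fun z => -ℓ (z - z₀)) z :=
      ((ℓ.analyticAt _).fun_comp (analyticAt_id.fun_sub analyticAt_const)).fun_neg
    exact ((h1.fun_pow n).fun_div analyticAt_const (by simp [Nat.factorial_ne_zero])).fun_mul
      (hWan n z (hsub' hz))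
  have hFb : ∀ n, ∀ z ∈ ball z₀ δ, ‖F n z‖ ≤ C * (1 / 2) ^ n := by
    intro n z hz
    refine (hcoef n n z hz).trans ?_
    calc _ = C * (K * ‖-ℓ (z - z₀)‖) ^ n := by
          rw [mul_pow]
          have : (n.factorial : ℝ) ≠ 0 := by exact_mod_cast n.factorial_ne_zero
          field_simp
      _ ≤ _ := by gcongr; exact hs z hz
  have hc : Summable fun n : ℕ => C * (1 / 2 : ℝ) ^ n :=
    (summable_geometric_of_lt_one (by norm_num) (by norm_num)).mul_left C
  refine ⟨fun z => ∑' n, F n z, analyticOnNhd_tsum hc hFan hFb z₀ (mem_ball_self hδpos), ?_, ?_⟩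
  · filter_upwards [ball_mem_nhds z₀ hδpos] with z hz
    have hsum := hasSum_fderiv_apply hc hFan hFb hz (v z)
    set A : ℕ → ℂ := fun n => (-ℓ (z - z₀)) ^ n / (n.factorial : ℂ) * W (n + 1) z with hA
    have hlin : HasFDerivAt (fun z => -ℓ (z - z₀)) (-ℓ) z := by
      exact (ℓ.hasFDerivAt.comp z ((hasFDerivAt_id z).sub_const z₀)).fun_neg
    have hterm : ∀ n, fderiv ℂ (F n) z (v z) =
        (-ℓ (z - z₀)) ^ n / (n.factorial : ℂ) * W (n + 1) z
          - n * (-ℓ (z - z₀)) ^ (n - 1) / (n.factorial : ℂ) * W n z := by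
      intro n
      have hWd : HasFDerivAt (W n) (fderiv ℂ (W n) z) z :=
        (hWan n z (hsub' hz)).differentiableAt.hasFDerivAt
      have h1 := ((hlin.pow n).mul_const ((n.factorial : ℂ)⁻¹)).mul hWd
      have hFn : F n = (fun y => (-ℓ (y - z₀)) ^ n * (n.factorial : ℂ)⁻¹) * W n := by
        ext y
        simp only [hF, div_eq_mul_inv, Pi.mul_apply]
      have h3 : W (n + 1) z = fderiv ℂ (W n) z (v z) := by
        simp only [hW]
        rw [Function.iterate_succ_apply']
        rfl
      rw [hFn, h1.fderiv, h3]
      simp [hℓ]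
      ring
    -- Since `v` differentiates `s` to `1`, the derivative of the `n`-th term is `A n - A (n - 1)`,
    -- and the sum telescopes. At `n = 0` the truncated exponent `n - 1` is harmless because of the
    -- factor `n`.
    have hpart : ∀ N, ∑ n ∈ Finset.range (N + 1), fderiv ℂ (F n) z (v z) = A N := by
      intro N
      induction N with
      | zero => simp [hterm, hA]
      | succ N ih =>
        rw [Finset.sum_range_succ, ih, hterm]
        simp only [hA, Nat.factorial_succ, Nat.add_sub_cancel]
        push_cast
        have : (N.factorial : ℂ) ≠ 0 := by exact_mod_cast N.factorial_ne_zero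
        have : (N : ℂ) + 1 ≠ 0 := by exact_mod_cast N.succ_ne_zero
        field_simp
        ring
    have hA0 : Filter.Tendsto A Filter.atTop (𝓝 0) := by
      have hbd : ∀ n, ‖A n‖ ≤ C * K * (n * (1 / 2) ^ n + (1 / 2) ^ n) := by
        intro n
        refine (hcoef (n + 1) n z hz).trans ?_
        calc _ = C * K * (n + 1) * (K * ‖-ℓ (z - z₀)‖) ^ n := by
              rw [mul_pow, Nat.factorial_succ, pow_succ]
              have : (n.factorial : ℝ) ≠ 0 := by exact_mod_cast n.factorial_ne_zero
              push_cast
              field_simp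
          _ ≤ C * K * (n + 1) * (1 / 2) ^ n := by gcongr; exact hs z hz
          _ = _ := by ring
      refine squeeze_zero_norm hbd ?_
      have h1 : Filter.Tendsto (fun n : ℕ => (n : ℝ) * (1 / 2 : ℝ) ^ n) Filter.atTop (𝓝 0) :=
        tendsto_self_mul_const_pow_of_lt_one (by norm_num) (by norm_num)
      have h2 : Filter.Tendsto (fun n : ℕ => (1 / 2 : ℝ) ^ n) Filter.atTop (𝓝 0) :=
        tendsto_pow_atTop_nhds_zero_of_lt_one (by norm_num) (by norm_num)
      simpa using (h1.add h2).const_mul (C * K)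
    have h1 := (Filter.tendsto_add_atTop_iff_nat 1).2 hsum.tendsto_sum_nat
    simp only [hpart] at h1
    exact tendsto_nhds_unique h1 hA0
  · intro a ha
    have hd := (analyticOnNhd_tsum hc hFan hFb z₀ (mem_ball_self hδpos)).differentiableAt
    have h1 := hasDerivAt_comp_line (a := a) hd
    have h2 : HasDerivAt (fun t : ℂ => f (z₀ + t • a)) (f a) 0 := by
      simpa using hasDerivAt_comp_line (a := a) (f.differentiableAt (x := z₀))
    refine h1.unique (h2.congr_of_eventuallyEq (Filter.Eventually.of_forall fun t => ?_))
    -- On the slice `s = 0` only the term `n = 0` survives, so the first integral agrees there with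
    -- `f`.
    have hz : ∀ n ≠ 0, F n (z₀ + t • a) = 0 := by
      intro n hn
      simp [hF, ha, hn]
    simp only
    rw [tsum_eq_single 0 hz]
    simp [hF, hW]

end ClosedDiff
end

noncomputable section

namespace ClosedDiff

open Metric

/-! ### Calculus of partial derivatives -/

lemma partial₁_mul {f g : ℂ × ℂ → ℂ} {z : ℂ × ℂ} (hf : DifferentiableAt ℂ f z)
    (hg : DifferentiableAt ℂ g z) :
    partial₁ (fun y => f y * g y) z = partial₁ f z * g z + f z * partial₁ g z := by
  simp only [partial₁]
  rw [fderiv_fun_mul hf hg]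
  simp
  ring

lemma partial₂_mul {f g : ℂ × ℂ → ℂ} {z : ℂ × ℂ} (hf : DifferentiableAt ℂ f z)
    (hg : DifferentiableAt ℂ g z) :
    partial₂ (fun y => f y * g y) z = partial₂ f z * g z + f z * partial₂ g z := by
  simp only [partial₂]
  rw [fderiv_fun_mul hf hg]
  simp
  ring

lemma partial₁_add {f g : ℂ × ℂ → ℂ} {z : ℂ × ℂ} (hf : DifferentiableAt ℂ f z)
    (hg : DifferentiableAt ℂ g z) :
    partial₁ (fun y => f y + g y) z = partial₁ f z + partial₁ g z := by
  simp only [partial₁]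
  rw [fderiv_fun_add hf hg]
  simp

lemma partial₂_add {f g : ℂ × ℂ → ℂ} {z : ℂ × ℂ} (hf : DifferentiableAt ℂ f z)
    (hg : DifferentiableAt ℂ g z) :
    partial₂ (fun y => f y + g y) z = partial₂ f z + partial₂ g z := by
  simp only [partial₂]
  rw [fderiv_fun_add hf hg]
  simp

lemma partial₁_div_const {f : ℂ × ℂ → ℂ} {z : ℂ × ℂ} (hf : DifferentiableAt ℂ f z) (a : ℂ) :
    partial₁ (fun y => f y / a) z = partial₁ f z / a := by
  simp only [partial₁, div_eq_mul_inv]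
  rw [fderiv_mul_const hf]
  simp [mul_comm]

lemma partial₂_div_const {f : ℂ × ℂ → ℂ} {z : ℂ × ℂ} (hf : DifferentiableAt ℂ f z) (a : ℂ) :
    partial₂ (fun y => f y / a) z = partial₂ f z / a := by
  simp only [partial₂, div_eq_mul_inv]
  rw [fderiv_mul_const hf]
  simp [mul_comm]

lemma partial₁_congr {f g : ℂ × ℂ → ℂ} {z : ℂ × ℂ} (h : f =ᶠ[𝓝 z] g) :
    partial₁ f =ᶠ[𝓝 z] partial₁ g :=
  (h.fderiv (𝕜 := ℂ)).mono fun _ hy => by simp only [partial₁, hy]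

lemma partial₂_congr {f g : ℂ × ℂ → ℂ} {z : ℂ × ℂ} (h : f =ᶠ[𝓝 z] g) :
    partial₂ f =ᶠ[𝓝 z] partial₂ g :=
  (h.fderiv (𝕜 := ℂ)).mono fun _ hy => by simp only [partial₂, hy]

lemma analyticAt_fderiv_apply {f : ℂ × ℂ → ℂ} {z : ℂ × ℂ} (hf : AnalyticAt ℂ f z) (a : ℂ × ℂ) :
    AnalyticAt ℂ (fun y => fderiv ℂ f y a) z :=
  ((ContinuousLinearMap.apply ℂ ℂ a).analyticAt _).fun_comp hf.fderiv

lemma analyticAt_partial₁ {f : ℂ × ℂ → ℂ} {z : ℂ × ℂ} (hf : AnalyticAt ℂ f z) :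
    AnalyticAt ℂ (partial₁ f) z := analyticAt_fderiv_apply hf _

lemma analyticAt_partial₂ {f : ℂ × ℂ → ℂ} {z : ℂ × ℂ} (hf : AnalyticAt ℂ f z) :
    AnalyticAt ℂ (partial₂ f) z := analyticAt_fderiv_apply hf _

/-- Symmetry of second derivatives. -/
lemma partial₁_partial₂ {f : ℂ × ℂ → ℂ} {z : ℂ × ℂ} (hf : AnalyticAt ℂ f z) :
    partial₁ (partial₂ f) z = partial₂ (partial₁ f) z := by
  have h : ∀ a b : ℂ × ℂ, fderiv ℂ (fun y => fderiv ℂ f y a) z b = fderiv ℂ (fderiv ℂ f) z b a := by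
    intro a b
    rw [fderiv_clm_apply hf.fderiv.differentiableAt (differentiableAt_const a)]
    simp
  have hs : IsSymmSndFDerivAt ℂ f z := (hf.contDiffAt (n := ω)).isSymmSndFDerivAt (by simp)
  exact (h (0, 1) (1, 0)).trans ((hs.eq _ _).trans (h (1, 0) (0, 1)).symm)

lemma hasDerivAt_fst {f : ℂ × ℂ → ℂ} {x y : ℂ} (hf : DifferentiableAt ℂ f (x, y)) :
    HasDerivAt (fun t => f (t, y)) (partial₁ f (x, y)) x :=
  hf.hasFDerivAt.comp_hasDerivAt x ((hasDerivAt_id x).prodMk (hasDerivAt_const x y))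

lemma hasDerivAt_snd {f : ℂ × ℂ → ℂ} {x y : ℂ} (hf : DifferentiableAt ℂ f (x, y)) :
    HasDerivAt (fun t => f (x, t)) (partial₂ f (x, y)) y :=
  hf.hasFDerivAt.comp_hasDerivAt y ((hasDerivAt_const y x).prodMk (hasDerivAt_id y))

lemma fderiv_apply_eq_partial (f : ℂ × ℂ → ℂ) (z a : ℂ × ℂ) :
    fderiv ℂ f z a = a.1 * partial₁ f z + a.2 * partial₂ f z := by
  have : a = a.1 • ((1, 0) : ℂ × ℂ) + a.2 • ((0, 1) : ℂ × ℂ) := by ext <;> simp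
  conv_lhs => rw [this, map_add, map_smul, map_smul]
  rfl

/-! ### Brioschi's formula -/

/-- Products of closed forms have zero curvature. -/
theorem brioschi_eq_zero {E F G a₁ a₂ b₁ b₂ : ℂ × ℂ → ℂ} {z : ℂ × ℂ}
    (ha₁ : AnalyticAt ℂ a₁ z) (ha₂ : AnalyticAt ℂ a₂ z)
    (hb₁ : AnalyticAt ℂ b₁ z) (hb₂ : AnalyticAt ℂ b₂ z)
    (ha : partial₁ a₂ =ᶠ[𝓝 z] partial₂ a₁) (hb : partial₁ b₂ =ᶠ[𝓝 z] partial₂ b₁)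
    (hE : E =ᶠ[𝓝 z] fun y => a₁ y * b₁ y)
    (hF : F =ᶠ[𝓝 z] fun y => (a₁ y * b₂ y + a₂ y * b₁ y) / 2)
    (hG : G =ᶠ[𝓝 z] fun y => a₂ y * b₂ y) : brioschi E F G z = 0 := by
  have ev : ∀ {f : ℂ × ℂ → ℂ}, AnalyticAt ℂ f z → ∀ᶠ y in 𝓝 z, DifferentiableAt ℂ f y :=
    fun hf => hf.eventually_analyticAt.mono fun _ h => h.differentiableAt
  have hE1 : partial₁ E =ᶠ[𝓝 z] fun y => partial₁ a₁ y * b₁ y + a₁ y * partial₁ b₁ y := by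
    filter_upwards [partial₁_congr hE, ev ha₁, ev hb₁] with y h h1 h2
    rw [h, partial₁_mul h1 h2]
  have hE2 : partial₂ E =ᶠ[𝓝 z] fun y => partial₂ a₁ y * b₁ y + a₁ y * partial₂ b₁ y := by
    filter_upwards [partial₂_congr hE, ev ha₁, ev hb₁] with y h h1 h2
    rw [h, partial₂_mul h1 h2]
  -- Closedness eliminates `∂₁a₂` and `∂₁b₂` in favour of `∂₂a₁` and `∂₂b₁`. This brings all
  -- derivatives to a normal form in which the final cancellation is purely algebraic.
  have hG1 : partial₁ G =ᶠ[𝓝 z] fun y => partial₂ a₁ y * b₂ y + a₂ y * partial₂ b₁ y := by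
    filter_upwards [partial₁_congr hG, ev ha₂, ev hb₂, ha, hb] with y h h1 h2 h3 h4
    rw [h, partial₁_mul h1 h2, h3, h4]
  have hG2 : partial₂ G =ᶠ[𝓝 z] fun y => partial₂ a₂ y * b₂ y + a₂ y * partial₂ b₂ y := by
    filter_upwards [partial₂_congr hG, ev ha₂, ev hb₂] with y h h1 h2
    rw [h, partial₂_mul h1 h2]
  have hF1 : partial₁ F =ᶠ[𝓝 z] fun y => ((partial₁ a₁ y * b₂ y + a₁ y * partial₂ b₁ y)
      + (partial₂ a₁ y * b₁ y + a₂ y * partial₁ b₁ y)) / 2 := by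
    filter_upwards [partial₁_congr hF, ev ha₁, ev hb₁, ev ha₂, ev hb₂, ha, hb]
      with y h h1 h2 h3 h4 h5 h6
    rw [h, partial₁_div_const ((h1.fun_mul h4).fun_add (h3.fun_mul h2)),
      partial₁_add (h1.fun_mul h4) (h3.fun_mul h2), partial₁_mul h1 h4,
      partial₁_mul h3 h2, h5, h6]
  have hF2 : partial₂ F =ᶠ[𝓝 z] fun y => ((partial₂ a₁ y * b₂ y + a₁ y * partial₂ b₂ y)
      + (partial₂ a₂ y * b₁ y + a₂ y * partial₂ b₁ y)) / 2 := by
    filter_upwards [partial₂_congr hF, ev ha₁, ev hb₁, ev ha₂, ev hb₂]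
      with y h h1 h2 h3 h4
    rw [h, partial₂_div_const ((h1.fun_mul h4).fun_add (h3.fun_mul h2)),
      partial₂_add (h1.fun_mul h4) (h3.fun_mul h2), partial₂_mul h1 h4,
      partial₂_mul h3 h2]
  have da₁ := ha₁.differentiableAt
  have da₂ := ha₂.differentiableAt
  have db₁ := hb₁.differentiableAt
  have db₂ := hb₂.differentiableAt
  have da₁₁ := (analyticAt_partial₁ ha₁).differentiableAt
  have da₁₂ := (analyticAt_partial₂ ha₁).differentiableAt
  have db₁₁ := (analyticAt_partial₁ hb₁).differentiableAt
  have db₁₂ := (analyticAt_partial₂ hb₁).differentiableAt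
  have hE22 : partial₂ (partial₂ E) z = (partial₂ (partial₂ a₁) z * b₁ z
      + partial₂ a₁ z * partial₂ b₁ z)
      + (partial₂ a₁ z * partial₂ b₁ z + a₁ z * partial₂ (partial₂ b₁) z) := by
    rw [(partial₂_congr hE2).eq_of_nhds, partial₂_add (da₁₂.fun_mul db₁) (da₁.fun_mul db₁₂),
      partial₂_mul da₁₂ db₁, partial₂_mul da₁ db₁₂]
  have hG11 : partial₁ (partial₁ G) z = (partial₂ (partial₁ a₁) z * b₂ z
      + partial₂ a₁ z * partial₂ b₁ z)
      + (partial₂ a₁ z * partial₂ b₁ z + a₂ z * partial₂ (partial₁ b₁) z) := by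
    rw [(partial₁_congr hG1).eq_of_nhds, partial₁_add (da₁₂.fun_mul db₂) (da₂.fun_mul db₁₂),
      partial₁_mul da₁₂ db₂, partial₁_mul da₂ db₁₂, partial₁_partial₂ ha₁, partial₁_partial₂ hb₁,
      ha.eq_of_nhds, hb.eq_of_nhds]
  have hF12 : partial₂ (partial₁ F) z =
      (((partial₂ (partial₁ a₁) z * b₂ z + partial₁ a₁ z * partial₂ b₂ z)
        + (partial₂ a₁ z * partial₂ b₁ z + a₁ z * partial₂ (partial₂ b₁) z))
      + ((partial₂ (partial₂ a₁) z * b₁ z + partial₂ a₁ z * partial₂ b₁ z)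
        + (partial₂ a₂ z * partial₁ b₁ z + a₂ z * partial₂ (partial₁ b₁) z))) / 2 := by
    rw [(partial₂_congr hF1).eq_of_nhds, partial₂_div_const
        (((da₁₁.fun_mul db₂).fun_add (da₁.fun_mul db₁₂)).fun_add
          ((da₁₂.fun_mul db₁).fun_add (da₂.fun_mul db₁₁))),
      partial₂_add ((da₁₁.fun_mul db₂).fun_add (da₁.fun_mul db₁₂))
        ((da₁₂.fun_mul db₁).fun_add (da₂.fun_mul db₁₁)),
      partial₂_add (da₁₁.fun_mul db₂) (da₁.fun_mul db₁₂),
      partial₂_add (da₁₂.fun_mul db₁) (da₂.fun_mul db₁₁),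
      partial₂_mul da₁₁ db₂, partial₂_mul da₁ db₁₂, partial₂_mul da₁₂ db₁, partial₂_mul da₂ db₁₁]
  rw [brioschi, Matrix.det_fin_three, Matrix.det_fin_three]
  simp only [hE22, hG11, hF12, hE1.eq_of_nhds, hE2.eq_of_nhds, hG1.eq_of_nhds, hG2.eq_of_nhds,
    hF1.eq_of_nhds, hF2.eq_of_nhds, hE.eq_of_nhds, hF.eq_of_nhds, hG.eq_of_nhds,
    Matrix.of_apply, Matrix.cons_val', Matrix.cons_val_zero, Matrix.cons_val_one, Matrix.cons_val]
  -- The numerator is zero as a polynomial in these derivatives, so no nondegeneracy at `z` is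
  -- needed.
  rw [div_eq_zero_iff]
  left
  ring

/-- The curvature of `2F dz₁dz₂`. -/
theorem brioschi_of_null {E F G : ℂ × ℂ → ℂ} {z : ℂ × ℂ} (hE : E =ᶠ[𝓝 z] fun _ => 0)
    (hG : G =ᶠ[𝓝 z] fun _ => 0) (hF : F z ≠ 0) (h : brioschi E F G z = 0) :
    F z * partial₂ (partial₁ F) z = partial₁ F z * partial₂ F z := by
  have c1 : partial₁ (fun _ : ℂ × ℂ => (0 : ℂ)) = fun _ => 0 := by ext; simp [partial₁]
  have c2 : partial₂ (fun _ : ℂ × ℂ => (0 : ℂ)) = fun _ => 0 := by ext; simp [partial₂]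
  have hE1 := partial₁_congr hE
  have hE2 := partial₂_congr hE
  have hG1 := partial₁_congr hG
  have hG2 := partial₂_congr hG
  rw [c1] at hE1 hG1
  rw [c2] at hE2 hG2
  have hE22 := partial₂_congr hE2
  have hG11 := partial₁_congr hG1
  rw [c1] at hG11
  rw [c2] at hE22
  rw [brioschi, Matrix.det_fin_three, Matrix.det_fin_three] at h
  simp only [hE22.eq_of_nhds, hG11.eq_of_nhds, hE1.eq_of_nhds, hE2.eq_of_nhds, hG1.eq_of_nhds,
    hG2.eq_of_nhds, hE.eq_of_nhds, hG.eq_of_nhds,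
    Matrix.of_apply, Matrix.cons_val', Matrix.cons_val_zero, Matrix.cons_val_one,
    Matrix.cons_val] at h
  rw [div_eq_zero_iff] at h
  -- With `E = G = 0` near `z`, the second determinant vanishes and the first equals `-F (F F₁₂ -
  -- F₁F₂)`.
  have h' : F z * (F z * partial₂ (partial₁ F) z - partial₁ F z * partial₂ F z) = 0 := by
    rcases h with h | h
    · linear_combination -h
    · exact absurd h (by simp [hF])
  exact sub_eq_zero.1 ((mul_eq_zero.1 h').resolve_left hF)

/-- A holomorphic function `c` on a polydisc with `∂₁∂₂ log c = 0` is a product of functions of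
one variable. -/
theorem exists_eq_mul_of_partial {c : ℂ × ℂ → ℂ} {p z₀ : ℂ × ℂ} {r : ℝ}
    (hc : AnalyticOnNhd ℂ c (ball p r)) (hz₀ : z₀ ∈ ball p r) (hcz₀ : c z₀ ≠ 0)
    (h : ∀ z ∈ ball p r, c z ≠ 0 → c z * partial₂ (partial₁ c) z = partial₁ c z * partial₂ c z) :
    ∃ A B : ℂ → ℂ, DifferentiableOn ℂ A (ball p.1 r) ∧ DifferentiableOn ℂ B (ball p.2 r) ∧
      ∀ z ∈ ball p r, c z = A z.1 * B z.2 := by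
  obtain ⟨x₀, y₀⟩ := z₀
  have hz₀' := hz₀
  rw [← ball_prod_same] at hz₀'
  have mem : ∀ {x y}, x ∈ ball p.1 r → y ∈ ball p.2 r → (x, y) ∈ ball p r := by
    intro x y hx hy
    rw [← ball_prod_same]
    exact ⟨hx, hy⟩
  have hA : ∀ y ∈ ball p.2 r, ∀ x ∈ ball p.1 r, AnalyticAt ℂ c (x, y) :=
    fun y hy x hx => hc _ (mem hx hy)
  -- the functional equation near the base point
  have hloc : ∀ᶠ z in 𝓝 (x₀, y₀), c z * c (x₀, y₀) = c (z.1, y₀) * c (x₀, z.2) := by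
    have h1 : ∀ᶠ z in 𝓝 (x₀, y₀), z ∈ ball p r ∧ c z ≠ 0 :=
      (isOpen_ball.eventually_mem hz₀).and
        ((hc _ hz₀).continuousAt.eventually_ne hcz₀)
    obtain ⟨ε, hε, hball⟩ := eventually_nhds_iff_ball.1 h1
    filter_upwards [ball_mem_nhds _ hε] with z hz
    obtain ⟨x, y⟩ := z
    have hz' := hz
    rw [← ball_prod_same] at hz'
    have mem' : ∀ {x y}, x ∈ ball x₀ ε → y ∈ ball y₀ ε → (x, y) ∈ ball (x₀, y₀) ε := by
      intro x y hx hy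
      rw [← ball_prod_same]
      exact ⟨hx, hy⟩
    have hx0 : x₀ ∈ ball x₀ ε := mem_ball_self hε
    have hy0 : y₀ ∈ ball y₀ ε := mem_ball_self hε
    have dc : ∀ {x y}, x ∈ ball x₀ ε → y ∈ ball y₀ ε → AnalyticAt ℂ c (x, y) :=
      fun hx hy => hc _ (hball _ (mem' hx hy)).1
    have nc : ∀ {x y}, x ∈ ball x₀ ε → y ∈ ball y₀ ε → c (x, y) ≠ 0 :=
      fun hx hy => (hball _ (mem' hx hy)).2
    -- `∂₂(∂₁c / c) = 0`: the logarithmic derivative in `x` does not depend on `y`.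
    have step1 : ∀ x ∈ ball x₀ ε, ∀ y ∈ ball y₀ ε,
        partial₁ c (x, y) / c (x, y) = partial₁ c (x, y₀) / c (x, y₀) := by
      intro x hx y hy
      have hder : ∀ t ∈ ball y₀ ε, HasDerivAt (fun t => partial₁ c (x, t) / c (x, t)) 0 t := by
        intro t ht
        have h1 := (hasDerivAt_snd (analyticAt_partial₁ (dc hx ht)).differentiableAt).fun_div
          (hasDerivAt_snd (dc hx ht).differentiableAt) (nc hx ht)
        have h2 := h _ (hball _ (mem' hx ht)).1 (nc hx ht)
        refine h1.congr_deriv ?_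
        rw [div_eq_zero_iff]
        left
        linear_combination h2
      exact isOpen_ball.is_const_of_deriv_eq_zero (convex_ball y₀ ε).isPreconnected
        (fun t ht => (hder t ht).differentiableAt.differentiableWithinAt)
        (fun t ht => (hder t ht).deriv) hy hy0
    -- Equal logarithmic derivatives in `x` make the quotient `c(t, y) / c(t, y₀)` constant in `t`.
    have hder : ∀ t ∈ ball x₀ ε, HasDerivAt (fun t => c (t, y) / c (t, y₀)) 0 t := by
      intro t ht
      have h1 := (hasDerivAt_fst (dc ht hz'.2).differentiableAt).fun_div
        (hasDerivAt_fst (dc ht hy0).differentiableAt) (nc ht hy0)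
      have h2 := step1 t ht y hz'.2
      rw [div_eq_div_iff (nc ht hz'.2) (nc ht hy0)] at h2
      refine h1.congr_deriv ?_
      rw [div_eq_zero_iff]
      left
      linear_combination h2
    have h3 := isOpen_ball.is_const_of_deriv_eq_zero (convex_ball x₀ ε).isPreconnected
        (fun t ht => (hder t ht).differentiableAt.differentiableWithinAt)
        (fun t ht => (hder t ht).deriv) hz'.1 hx0
    simp only at h3
    rw [div_eq_div_iff (nc hz'.1 hy0) (nc hx0 hy0)] at h3
    rw [h3]
    ring
  -- Both sides are analytic on the polydisc (balls of `ℂ × ℂ` are products of discs), so the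
  -- identity theorem carries the equation across the zeros of `c`.
  have hglob : ∀ z ∈ ball p r, c z * c (x₀, y₀) = c (z.1, y₀) * c (x₀, z.2) := by
    have l : AnalyticOnNhd ℂ (fun z => c z * c (x₀, y₀)) (ball p r) :=
      fun z hz => (hc z hz).fun_mul analyticAt_const
    have l' : AnalyticOnNhd ℂ (fun z : ℂ × ℂ => c (z.1, y₀) * c (x₀, z.2)) (ball p r) := by
      intro z hz
      rw [← ball_prod_same] at hz
      refine AnalyticAt.fun_mul ?_ ?_
      · exact AnalyticAt.comp_of_eq (g := c) (hA y₀ hz₀'.2 z.1 hz.1)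
          (analyticAt_fst.prod analyticAt_const) rfl
      · exact AnalyticAt.comp_of_eq (g := c) (hA z.2 hz.2 x₀ hz₀'.1)
          (analyticAt_const.prod analyticAt_snd) rfl
    exact l.eqOn_of_preconnected_of_eventuallyEq l' (convex_ball p r).isPreconnected hz₀ hloc
  refine ⟨fun x => c (x, y₀), fun y => c (x₀, y) / c (x₀, y₀), ?_, ?_, ?_⟩
  · exact fun x hx =>
      (hasDerivAt_fst (hA y₀ hz₀'.2 x hx).differentiableAt).differentiableAt.differentiableWithinAt
  · exact fun y hy => ((hasDerivAt_snd
      (hA y hy x₀ hz₀'.1).differentiableAt).differentiableAt.div_const _).differentiableWithinAt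
  · intro z hz
    have := hglob z hz
    field_simp
    exact this

end ClosedDiff
end

noncomputable section

namespace ClosedDiff

/-! ### Null coordinates -/

/-- Square roots of non-vanishing holomorphic germs. -/
lemma exists_analyticAt_sqrt {d : ℂ × ℂ → ℂ} {p : ℂ × ℂ} (hd : AnalyticAt ℂ d p) (h0 : d p ≠ 0) :
    ∃ σ : ℂ × ℂ → ℂ, AnalyticAt ℂ σ p ∧ ∀ᶠ z in 𝓝 p, σ z ^ 2 = d z := by
  obtain ⟨s, hs⟩ := IsAlgClosed.exists_pow_nat_eq (d p) (n := 2) (by norm_num)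
  have hdiv : AnalyticAt ℂ (fun z => d z / d p) p := hd.fun_div analyticAt_const h0
  -- Dividing by `d p` moves the value at `p` to `1`, where the principal logarithm is analytic; `s`
  -- is a square root of `d p`.
  refine ⟨fun z => s * Complex.exp (Complex.log (d z / d p) / 2), ?_, ?_⟩
  · refine analyticAt_const.fun_mul (AnalyticAt.cexp' (AnalyticAt.fun_div ?_ analyticAt_const
      two_ne_zero))
    exact hdiv.clog (by simp [h0, Complex.one_mem_slitPlane])
  · filter_upwards [hd.continuousAt.eventually_ne h0] with z hz
    rw [mul_pow, ← Complex.exp_nat_mul, hs]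
    have : ((2 : ℕ) : ℂ) * (Complex.log (d z / d p) / 2) = Complex.log (d z / d p) := by
      push_cast
      ring
    rw [this, Complex.exp_log (div_ne_zero hz h0)]
    field_simp

/-- A nondegenerate binary quadratic form `E z₁² + 2F z₁z₂ + G z₂²` with holomorphic coefficients
is, up to a unit, a product `(E z₁ + D z₂)(D z₁ + G z₂)`. -/
lemma exists_factor {E F G : ℂ × ℂ → ℂ} {p : ℂ × ℂ} (hE : AnalyticAt ℂ E p)
    (hF : AnalyticAt ℂ F p) (hG : AnalyticAt ℂ G p) (hd : E p * G p - F p ^ 2 ≠ 0) :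
    ∃ D : ℂ × ℂ → ℂ, AnalyticAt ℂ D p ∧ D p ≠ 0 ∧ D p ^ 2 ≠ E p * G p ∧
      ∀ᶠ z in 𝓝 p, D z ^ 2 + E z * G z = 2 * F z * D z := by
  have key : ∀ σ : ℂ × ℂ → ℂ, AnalyticAt ℂ σ p →
      (∀ᶠ z in 𝓝 p, σ z ^ 2 = F z ^ 2 - E z * G z) → F p + σ p ≠ 0 →
      ∃ D : ℂ × ℂ → ℂ, AnalyticAt ℂ D p ∧ D p ≠ 0 ∧ D p ^ 2 ≠ E p * G p ∧
      ∀ᶠ z in 𝓝 p, D z ^ 2 + E z * G z = 2 * F z * D z := by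
    intro σ hσ hσ2 hne
    refine ⟨fun z => F z + σ z, hF.fun_add hσ, hne, fun h => ?_, ?_⟩
    · have h2 := hσ2.self_of_nhds
      have h3 : σ p * (F p + σ p) = 0 := by linear_combination (h + h2) / 2
      rcases mul_eq_zero.1 h3 with h4 | h4
      · rw [h4] at h2
        exact hd (by linear_combination h2)
      · exact hne h4
    · filter_upwards [hσ2] with z hz
      linear_combination hz
  obtain ⟨σ, hσ, hσ2⟩ := exists_analyticAt_sqrt ((hF.fun_pow 2).fun_sub (hE.fun_mul hG))
    (fun h => hd (by linear_combination -h))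
  -- `D = F ± σ` are the roots of `D² - 2FD + EG = 0`. They cannot both vanish at `p`, since then
  -- `F` and `σ` would vanish there, and with them the discriminant. A nonzero root covers the case
  -- `E p = 0` or `G p = 0` as well.
  by_cases h : F p + σ p = 0
  · refine key (fun z => -σ z) hσ.fun_neg (hσ2.mono fun z hz => by rw [← hz]; ring) fun h' => ?_
    have h2 := hσ2.self_of_nhds
    have h3 : σ p = 0 := by linear_combination (h - h') / 2
    rw [h3] at h2
    exact hd (by linear_combination h2)
  · exact key σ hσ hσ2 h

/-- If the derivative of the local diffeomorphism `φ` maps the isotropic vector `V ≠ 0` to a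
multiple of `b`, then the preimage of `b` is isotropic. -/
lemma isotropic_of_map_eq {E F G : ℂ} {V a b : ℂ × ℂ} {L : ℂ × ℂ →L[ℂ] ℂ × ℂ}
    (hL : Function.Injective L) (ha : L a = b) {k : ℂ} (hV : L V = k • b) (hV0 : V ≠ 0)
    (hQ : E * V.1 ^ 2 + 2 * F * V.1 * V.2 + G * V.2 ^ 2 = 0) :
    E * a.1 ^ 2 + 2 * F * a.1 * a.2 + G * a.2 ^ 2 = 0 := by
  have h1 : V = k • a := hL (by rw [map_smul, ha, hV])
  have hk : k ≠ 0 := by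
    rintro rfl
    exact hV0 (by rw [h1, zero_smul])
  rw [h1] at hQ
  simp only [Prod.smul_fst, Prod.smul_snd, smul_eq_mul] at hQ
  have : k ^ 2 * (E * a.1 ^ 2 + 2 * F * a.1 * a.2 + G * a.2 ^ 2) = 0 := by
    linear_combination hQ
  exact (mul_eq_zero.1 this).resolve_left (pow_ne_zero 2 hk)

/-- A nondegenerate holomorphic quadratic form in two variables has local null coordinates. -/
theorem exists_null_coordinates {E F G : ℂ × ℂ → ℂ} {p : ℂ × ℂ} (hE : AnalyticAt ℂ E p)
    (hF : AnalyticAt ℂ F p) (hG : AnalyticAt ℂ G p) (hd : E p * G p - F p ^ 2 ≠ 0) :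
    ∃ φ : OpenPartialHomeomorph (ℂ × ℂ) (ℂ × ℂ), p ∈ φ.source ∧
      AnalyticOnNhd ℂ φ φ.source ∧ AnalyticOnNhd ℂ φ.symm φ.target ∧
      ∀ z ∈ φ.target, ∀ b : ℂ × ℂ, b = (1, 0) ∨ b = (0, 1) →
        E (φ.symm z) * (fderiv ℂ φ.symm z b).1 ^ 2
          + 2 * F (φ.symm z) * (fderiv ℂ φ.symm z b).1 * (fderiv ℂ φ.symm z b).2
          + G (φ.symm z) * (fderiv ℂ φ.symm z b).2 ^ 2 = 0 := by
  obtain ⟨D, hD, hD0, hDEG, hDq⟩ := exists_factor hE hF hG hd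
  have hED := hE.fun_div hD hD0
  have hGD := hG.fun_div hD hD0
  -- The isotropic directions: `V₁` spans the kernel of `E z₁ + D z₂` and `V₂` that of `D z₁ + G
  -- z₂`, each scaled to have one coordinate equal to `1`.
  set V₁ : ℂ × ℂ → ℂ × ℂ := fun z => (1, -(E z / D z)) with hV₁
  set V₂ : ℂ × ℂ → ℂ × ℂ := fun z => (-(G z / D z), 1) with hV₂
  obtain ⟨u, hu, hu0, hu1⟩ := exists_firstIntegral (v := V₁)
    (analyticAt_const.prod hED.fun_neg) (ContinuousLinearMap.fst ℂ ℂ ℂ)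
    (ContinuousLinearMap.snd ℂ ℂ ℂ) (fun z => rfl)
  obtain ⟨v, hv, hv0, hv1⟩ := exists_firstIntegral (v := V₂)
    (hGD.fun_neg.prod analyticAt_const) (ContinuousLinearMap.snd ℂ ℂ ℂ)
    (ContinuousLinearMap.fst ℂ ℂ ℂ) (fun z => rfl)
  set ψ : ℂ × ℂ → ℂ × ℂ := fun z => (u z, v z) with hψdef
  have hψ : AnalyticAt ℂ ψ p := hu.prod hv
  have hfd : ∀ z, DifferentiableAt ℂ u z → DifferentiableAt ℂ v z → ∀ a,
      fderiv ℂ ψ z a = (fderiv ℂ u z a, fderiv ℂ v z a) := by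
    intro z h1 h2 a
    rw [hψdef, h1.fderiv_prodMk h2]
    rfl
  -- Up to the factor `1 / D`, the differentials of `u` and `v` at `p` are the two linear factors of
  -- the form. They are independent because `D² ≠ EG`.
  have hinj : Function.Injective (fderiv ℂ ψ p) := by
    rw [injective_iff_map_eq_zero]
    intro a ha
    rw [hfd p hu.differentiableAt hv.differentiableAt, Prod.mk_eq_zero] at ha
    have hu2 : partial₂ u p = 1 := hu1 (0, 1) rfl
    have hv2 : partial₁ v p = 1 := hv1 (1, 0) rfl
    have hu3 := hu0.self_of_nhds
    have hv3 := hv0.self_of_nhds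
    rw [fderiv_apply_eq_partial] at hu3 hv3
    rw [fderiv_apply_eq_partial, fderiv_apply_eq_partial] at ha
    simp only [hV₁, hV₂, hu2, hv2] at hu3 hv3 ha
    have e1 : partial₁ u p = E p / D p := by linear_combination hu3
    have e2 : partial₂ v p = G p / D p := by linear_combination hv3
    rw [e1, e2] at ha
    obtain ⟨h1, h2⟩ := ha
    field_simp at h1 h2
    have h3 : a.1 * (D p ^ 2 - E p * G p) = 0 := by linear_combination D p * h2 - G p * h1
    have h4 : a.1 = 0 := (mul_eq_zero.1 h3).resolve_right (sub_ne_zero.2 hDEG)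
    have h5 : D p * a.2 = 0 := by linear_combination h1 - E p * h4
    exact Prod.ext h4 ((mul_eq_zero.1 h5).resolve_left hD0)
  set L : (ℂ × ℂ) ≃L[ℂ] ℂ × ℂ :=
    (LinearEquiv.ofInjectiveEndo (fderiv ℂ ψ p : ℂ × ℂ →ₗ[ℂ] ℂ × ℂ) hinj).toContinuousLinearEquiv
    with hL
  have hLeq : (L : ℂ × ℂ →L[ℂ] ℂ × ℂ) = fderiv ℂ ψ p := by
    ext <;> rfl
  have hstrict : HasStrictFDerivAt ψ (L : ℂ × ℂ →L[ℂ] ℂ × ℂ) p := by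
    rw [hLeq]
    exact hψ.hasStrictFDerivAt
  -- Invertibility of the derivative is an open condition. It is required on the whole source, so
  -- that the inverse is analytic at every point of the target.
  have hrange : ∀ᶠ z in 𝓝 p,
      fderiv ℂ ψ z ∈ Set.range ((↑) : ((ℂ × ℂ) ≃L[ℂ] ℂ × ℂ) → ℂ × ℂ →L[ℂ] ℂ × ℂ) :=
    hψ.fderiv.continuousAt.eventually
      (ContinuousLinearEquiv.isOpen.mem_nhds ⟨L, hLeq⟩)
  have hev : ∀ᶠ z in 𝓝 p, (AnalyticAt ℂ u z ∧ AnalyticAt ℂ v z) ∧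
      fderiv ℂ ψ z ∈ Set.range ((↑) : ((ℂ × ℂ) ≃L[ℂ] ℂ × ℂ) → ℂ × ℂ →L[ℂ] ℂ × ℂ) ∧
      (fderiv ℂ u z (V₁ z) = 0 ∧ fderiv ℂ v z (V₂ z) = 0) ∧ D z ≠ 0 ∧
      D z ^ 2 + E z * G z = 2 * F z * D z :=
    (hu.eventually_analyticAt.and hv.eventually_analyticAt).and <| hrange.and <|
      (hu0.and hv0).and <| (hD.continuousAt.eventually_ne hD0).and hDq
  obtain ⟨S, hS, hSo, hpS⟩ := _root_.eventually_nhds_iff.1 hev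
  set φ := (hstrict.toOpenPartialHomeomorph ψ).restrOpen S hSo with hφ
  have hφψ : (φ : ℂ × ℂ → ℂ × ℂ) = ψ := rfl
  have hsrc : ∀ z ∈ φ.source, z ∈ S := fun z hz => hz.2
  have han : AnalyticOnNhd ℂ φ φ.source := fun z hz =>
    (hS z (hsrc z hz)).1.1.prod (hS z (hsrc z hz)).1.2
  have hsymm : AnalyticOnNhd ℂ φ.symm φ.target := by
    intro z hz
    obtain ⟨i, hi⟩ := (hS _ (hsrc _ (φ.map_target hz))).2.1
    exact φ.analyticAt_symm hz (han _ (φ.map_target hz)) hi.symm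
  refine ⟨φ, ⟨hstrict.mem_toOpenPartialHomeomorph_source, hpS⟩, han, hsymm, ?_⟩
  intro z hz b hb
  have hz' := φ.map_target hz
  obtain ⟨⟨hua, hva⟩, ⟨i, hi⟩, ⟨hVu, hVv⟩, hDz, hq⟩ := hS _ (hsrc _ hz')
  set y := φ.symm z with hy
  have hLinj : Function.Injective (fderiv ℂ ψ y) := by
    rw [← hi]
    exact i.injective
  have hcomp : ∀ b, fderiv ℂ ψ y (fderiv ℂ φ.symm z b) = b := by
    intro b
    have h1 : (fun t => ψ (φ.symm t)) =ᶠ[𝓝 z] fun t => t := by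
      filter_upwards [φ.open_target.mem_nhds hz] with t ht
      exact φ.right_inv ht
    have h2 : HasFDerivAt (fun t => ψ (φ.symm t)) ((fderiv ℂ ψ y).comp (fderiv ℂ φ.symm z)) z :=
      ((hua.prod hva).differentiableAt.hasFDerivAt : HasFDerivAt ψ (fderiv ℂ ψ y) y).comp z
        (hsymm z hz).differentiableAt.hasFDerivAt
    have h3 := (h2.congr_of_eventuallyEq h1.symm).unique (hasFDerivAt_id z)
    exact DFunLike.congr_fun h3 b
  rcases hb with rfl | rfl
  -- `v` is constant along `V₂`, so `V₂` is a multiple of the first coordinate vector; likewise `V₁`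
  -- and the second one below.
  · refine isotropic_of_map_eq (V := V₂ y) (k := fderiv ℂ u y (V₂ y)) hLinj (hcomp _) ?_ ?_ ?_
    · rw [hfd y hua.differentiableAt hva.differentiableAt, hVv]
      simp
    · simp [hV₂]
    · simp only [hV₂]
      field_simp
      linear_combination G y * hq
  · refine isotropic_of_map_eq (V := V₁ y) (k := fderiv ℂ v y (V₁ y)) hLinj (hcomp _) ?_ ?_ ?_
    · rw [hfd y hua.differentiableAt hva.differentiableAt, hVu]
      simp
    · simp [hV₁]
    · simp only [hV₁]
      field_simp
      linear_combination E y * hq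

end ClosedDiff
end

noncomputable section

namespace ClosedDiff

open Set

/-! ### Transfer between the surface and its charts -/

section

variable {X : Type*} [TopologicalSpace X]

lemma eventually_mem_chart {U : Set X} (hU : IsOpen U) {e : OpenPartialHomeomorph X (ℂ × ℂ)}
    {z : ℂ × ℂ} (hz : z ∈ e.target) (hzU : e.symm z ∈ U) :
    ∀ᶠ y in 𝓝 z, y ∈ e.target ∧ e.symm y ∈ U :=
  (e.open_target.eventually_mem hz).and
    ((e.symm.continuousAt hz).eventually (hU.mem_nhds hzU))

/-- Used to extend identities between functions continuous at a point of the chart from a dense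
subset of the surface. -/
lemma frequently_mem_chart_of_dense {e : OpenPartialHomeomorph X (ℂ × ℂ)} {S : Set X}
    (hS : Dense S) {z : ℂ × ℂ} (hz : z ∈ e.target) :
    ∃ᶠ y in 𝓝 z, y ∈ e.target ∧ e.symm y ∈ S := by
  rw [Filter.frequently_iff]
  intro V hV
  obtain ⟨V', hV', hV'o, hzV'⟩ := mem_nhds_iff.1 (Filter.inter_mem hV (e.open_target.mem_nhds hz))
  have ho : IsOpen (e.source ∩ e ⁻¹' V') := e.isOpen_inter_preimage hV'o
  obtain ⟨x, hxV, hxS⟩ := hS.inter_open_nonempty _ ho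
    ⟨e.symm z, e.map_target hz, by rwa [mem_preimage, e.right_inv hz]⟩
  exact ⟨e x, (hV' hxV.2).1, e.map_source hxV.1, by rwa [e.left_inv hxV.1]⟩

end

section

variable {X : Type*} [TopologicalSpace X] [ChartedSpace (ℂ × ℂ) X]

/-! ### Charts and tangent vectors -/

lemma HolChart.mdifferentiableAt_symm {e : OpenPartialHomeomorph X (ℂ × ℂ)} (he : HolChart e)
    {z : ℂ × ℂ} (hz : z ∈ e.target) : MDifferentiableAt surfaceModel surfaceModel e.symm z :=
  ((contMDiffOn_symm_of_mem_maximalAtlas he).contMDiffAt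
    (e.open_target.mem_nhds hz)).mdifferentiableAt (by simp)

lemma HolChart.mdifferentiableAt {e : OpenPartialHomeomorph X (ℂ × ℂ)} (he : HolChart e)
    {y : X} (hy : y ∈ e.source) : MDifferentiableAt surfaceModel surfaceModel e y :=
  ((contMDiffOn_of_mem_maximalAtlas he).contMDiffAt
    (e.open_source.mem_nhds hy)).mdifferentiableAt (by simp)

/-- A biholomorphism of open subsets of `ℂ × ℂ` lies in the analytic groupoid, so the maximal atlas
absorbs it. This makes null coordinates a holomorphic chart, to which the curvature hypothesis
applies. -/
lemma HolChart.trans {e : OpenPartialHomeomorph X (ℂ × ℂ)} (he : HolChart e)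
    {φ : OpenPartialHomeomorph (ℂ × ℂ) (ℂ × ℂ)} (hφ : AnalyticOnNhd ℂ φ φ.source)
    (hφ' : AnalyticOnNhd ℂ φ.symm φ.target) : HolChart (e.trans φ) := by
  have hmem : φ ∈ contDiffGroupoid ω surfaceModel := by
    refine mem_groupoid_of_pregroupoid.2 ⟨?_, ?_⟩
    · have h : ContDiffOn ℂ ω φ φ.source :=
        fun z hz => (hφ z hz).contDiffAt.contDiffWithinAt
      simpa [contDiffPregroupoid] using h
    · have h : ContDiffOn ℂ ω φ.symm φ.target :=
        fun z hz => (hφ' z hz).contDiffAt.contDiffWithinAt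
      simpa [contDiffPregroupoid] using h
  have he' := mem_maximalAtlas_iff.1 he
  refine mem_maximalAtlas_iff.2 fun e' h => ⟨?_, ?_⟩
  · rw [OpenPartialHomeomorph.trans_symm_eq_symm_trans_symm, OpenPartialHomeomorph.trans_assoc]
    exact StructureGroupoid.trans _ (StructureGroupoid.symm _ hmem) (he' e' h).1
  · rw [← OpenPartialHomeomorph.trans_assoc]
    exact StructureGroupoid.trans _ (he' e' h).2 hmem

lemma chartVec_add (e : OpenPartialHomeomorph X (ℂ × ℂ)) (z a b : ℂ × ℂ) :
    chartVec e z (a + b) = chartVec e z a + chartVec e z b :=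
  map_add (mfderiv surfaceModel surfaceModel e.symm z) a b

lemma chartVec_eq (e : OpenPartialHomeomorph X (ℂ × ℂ)) (z a : ℂ × ℂ) :
    chartVec e z a = a.1 • chartVec e z (1, 0) + a.2 • chartVec e z (0, 1) := by
  have h : a = a.1 • ((1, 0) : ℂ × ℂ) + a.2 • ((0, 1) : ℂ × ℂ) := by ext <;> simp
  have h1 := chartVec_add e z (a.1 • ((1, 0) : ℂ × ℂ)) (a.2 • ((0, 1) : ℂ × ℂ))
  rw [← h] at h1
  rw [h1]
  congr 1
  · exact map_smul (mfderiv surfaceModel surfaceModel e.symm z) a.1 ((1, 0) : ℂ × ℂ)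
  · exact map_smul (mfderiv surfaceModel surfaceModel e.symm z) a.2 ((0, 1) : ℂ × ℂ)

lemma HolChart.chartVec_surjective {e : OpenPartialHomeomorph X (ℂ × ℂ)} (he : HolChart e)
    {z : ℂ × ℂ} (hz : z ∈ e.target) : Function.Surjective (chartVec e z) := by
  set L : ℂ × ℂ →L[ℂ] ℂ × ℂ := mfderiv surfaceModel surfaceModel e.symm z with hL
  have h1 := mfderiv_comp z (he.mdifferentiableAt (e.map_target hz)) (he.mdifferentiableAt_symm hz)
  have h2 : (e ∘ e.symm) =ᶠ[𝓝 z] id := by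
    filter_upwards [e.open_target.mem_nhds hz] with t ht
    exact e.right_inv ht
  rw [h2.mfderiv_eq] at h1
  have hinj : Function.Injective L := by
    intro a b hab
    have h3 : ∀ a : ℂ × ℂ, a = mfderiv surfaceModel surfaceModel e (e.symm z) (L a) := by
      intro a
      have := DFunLike.congr_fun h1 a
      rw [mfderiv_id] at this
      exact this
    rw [h3 a, h3 b, hab]
  exact LinearMap.surjective_of_injective (f := (L : ℂ × ℂ →ₗ[ℂ] ℂ × ℂ)) hinj

lemma HolChart.chartVec_trans {e : OpenPartialHomeomorph X (ℂ × ℂ)} (he : HolChart e)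
    {φ : OpenPartialHomeomorph (ℂ × ℂ) (ℂ × ℂ)} {z : ℂ × ℂ}
    (hz : z ∈ (e.trans φ).target) (hφ : DifferentiableAt ℂ φ.symm z) (a : ℂ × ℂ) :
    chartVec (e.trans φ) z a = chartVec e (φ.symm z) (fderiv ℂ φ.symm z a) := by
  rw [OpenPartialHomeomorph.trans_target] at hz
  have h1 := mfderiv_comp z (he.mdifferentiableAt_symm hz.2) hφ.mdifferentiableAt
  have h2 := DFunLike.congr_fun h1 a
  rw [mfderiv_eq_fderiv] at h2
  exact h2

/-! ### Holomorphic functions in charts -/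

lemma HolFunOn.analyticAt {f : X → ℂ} {U : Set X} (hf : HolFunOn f U) (hU : IsOpen U)
    {e : OpenPartialHomeomorph X (ℂ × ℂ)} (he : HolChart e) {z : ℂ × ℂ} (hz : z ∈ e.target)
    (hzU : e.symm z ∈ U) : AnalyticAt ℂ (fun y => f (e.symm y)) z := by
  have h1 : ContMDiffAt surfaceModel surfaceModel ω e.symm z :=
    (contMDiffOn_symm_of_mem_maximalAtlas he).contMDiffAt (e.open_target.mem_nhds hz)
  have h2 : ContMDiffAt surfaceModel 𝓘(ℂ, ℂ) ω f (e.symm z) := hf.contMDiffAt (hU.mem_nhds hzU)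
  exact (h2.comp z h1).contDiffAt.analyticAt

lemma HolChart.holFunOn_comp {e : OpenPartialHomeomorph X (ℂ × ℂ)} (he : HolChart e)
    {g : ℂ × ℂ → ℂ} {V : Set (ℂ × ℂ)} (hg : AnalyticOnNhd ℂ g V) :
    HolFunOn (fun y => g (e y)) (e.source ∩ e ⁻¹' V) := by
  intro y hy
  have h1 : ContMDiffAt surfaceModel surfaceModel ω e y :=
    (contMDiffOn_of_mem_maximalAtlas he).contMDiffAt (e.open_source.mem_nhds hy.1)
  have h2 : ContMDiffAt surfaceModel 𝓘(ℂ, ℂ) ω g (e y) :=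
    (hg _ hy.2).contDiffAt.contMDiffAt
  exact (h2.comp y h1).contMDiffWithinAt

/-! ### Exact forms -/

/-- The differential of a function. -/
def differential (f : X → ℂ) : CovectorField X := fun y =>
  ContinuousLinearMap.toLinearMap
    (mfderiv surfaceModel 𝓘(ℂ, ℂ) f y : TangentSpace surfaceModel y →L[ℂ] ℂ)

lemma differential_chartVec {f : X → ℂ} {U : Set X} (hf : HolFunOn f U) (hU : IsOpen U)
    {e : OpenPartialHomeomorph X (ℂ × ℂ)} (he : HolChart e) {z : ℂ × ℂ} (hz : z ∈ e.target)
    (hzU : e.symm z ∈ U) (a : ℂ × ℂ) :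
    differential f (e.symm z) (chartVec e z a) = fderiv ℂ (fun y => f (e.symm y)) z a := by
  have h2 : MDifferentiableAt surfaceModel 𝓘(ℂ, ℂ) f (e.symm z) :=
    (hf.contMDiffAt (hU.mem_nhds hzU)).mdifferentiableAt (by simp)
  have h1 := DFunLike.congr_fun (mfderiv_comp z h2 (he.mdifferentiableAt_symm hz)) a
  rw [mfderiv_eq_fderiv] at h1
  exact h1.symm

lemma holFormOn_differential {f : X → ℂ} {U : Set X} (hf : HolFunOn f U) (hU : IsOpen U) :
    HolFormOn (differential f) U := by
  intro e he z hz hzU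
  have han := hf.analyticAt hU he hz hzU
  have hev := eventually_mem_chart hU hz hzU
  constructor
  · refine (analyticAt_partial₁ han).congr ?_
    filter_upwards [hev] with y hy
    exact (differential_chartVec hf hU he hy.1 hy.2 (1, 0)).symm
  · refine (analyticAt_partial₂ han).congr ?_
    filter_upwards [hev] with y hy
    exact (differential_chartVec hf hU he hy.1 hy.2 (0, 1)).symm

lemma closedFormOn_differential {f : X → ℂ} {U : Set X} (hf : HolFunOn f U) (hU : IsOpen U) :
    ClosedFormOn (differential f) U := by
  intro e he z hz hzU
  have hev := eventually_mem_chart hU hz hzU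
  have h1 : coeff₁ (differential f) e =ᶠ[𝓝 z] partial₁ fun y => f (e.symm y) := by
    filter_upwards [hev] with y hy
    exact differential_chartVec hf hU he hy.1 hy.2 (1, 0)
  have h2 : coeff₂ (differential f) e =ᶠ[𝓝 z] partial₂ fun y => f (e.symm y) := by
    filter_upwards [hev] with y hy
    exact differential_chartVec hf hU he hy.1 hy.2 (0, 1)
  rw [(partial₁_congr h2).eq_of_nhds, (partial₂_congr h1).eq_of_nhds,
    partial₁_partial₂ (hf.analyticAt hU he hz hzU)]

/-! ### Quadratic forms in charts -/

lemma quad_chartVec (q : QuadraticField X) (e : OpenPartialHomeomorph X (ℂ × ℂ)) (z a : ℂ × ℂ) :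
    q (e.symm z) (chartVec e z a)
      = coeffE q e z * a.1 ^ 2 + 2 * coeffF q e z * a.1 * a.2 + coeffG q e z * a.2 ^ 2 := by
  rw [chartVec_eq, QuadraticMap.map_add (q (e.symm z)), QuadraticMap.map_smul, QuadraticMap.map_smul,
    QuadraticMap.polar_smul_left, QuadraticMap.polar_smul_right]
  simp only [coeffE, coeffF, coeffG, smul_eq_mul]
  ring

/-- `q` is nondegenerate at `x`. -/
def NondegenerateAt (q : QuadraticField X) (x : X) : Prop :=
  ∃ a b : TangentSpace surfaceModel x,
    q x a * q x b - (QuadraticMap.polar (q x) a b / 2) ^ 2 ≠ 0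

/-- The Gram determinant of a pair `a`, `b` is `(a₁b₂ - a₂b₁)²` times the discriminant in the chart,
so nondegeneracy does not depend on the chart. -/
lemma HolChart.discr_ne_zero_iff {e : OpenPartialHomeomorph X (ℂ × ℂ)} (he : HolChart e)
    (q : QuadraticField X) {z : ℂ × ℂ} (hz : z ∈ e.target) :
    discr q e z ≠ 0 ↔ NondegenerateAt q (e.symm z) := by
  refine ⟨fun h => ⟨_, _, h⟩, ?_⟩
  rintro ⟨s, t, hst⟩ h
  obtain ⟨a, rfl⟩ := he.chartVec_surjective hz s
  obtain ⟨b, rfl⟩ := he.chartVec_surjective hz t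
  apply hst
  rw [QuadraticMap.polar, ← chartVec_add, quad_chartVec, quad_chartVec, quad_chartVec]
  rw [discr] at h
  simp only [Prod.fst_add, Prod.snd_add]
  linear_combination (a.1 * b.2 - a.2 * b.1) ^ 2 * h

lemma HolChart.discr_apply_ne_zero_iff {e : OpenPartialHomeomorph X (ℂ × ℂ)} (he : HolChart e)
    (q : QuadraticField X) {y : X} (hy : y ∈ e.source) :
    discr q e (e y) ≠ 0 ↔ NondegenerateAt q y := by
  rw [he.discr_ne_zero_iff q (e.map_source hy), e.left_inv hy]

lemma HolQuadOn.analyticAt_discr {q : QuadraticField X} {U : Set X} (hq : HolQuadOn q U)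
    {e : OpenPartialHomeomorph X (ℂ × ℂ)} (he : HolChart e) {z : ℂ × ℂ} (hz : z ∈ e.target)
    (hzU : e.symm z ∈ U) : AnalyticAt ℂ (discr q e) z := by
  obtain ⟨hE, hF, hG⟩ := hq e he z hz hzU
  exact (hE.fun_mul hG).fun_sub (hF.fun_pow 2)

lemma discr_of_eq_mul {w q : QuadraticField X} {c : ℂ} {e : OpenPartialHomeomorph X (ℂ × ℂ)}
    {z : ℂ × ℂ} (h : ∀ v, w (e.symm z) v = c * q (e.symm z) v) :
    discr w e z = discr q e z * c ^ 2 := by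
  simp only [discr, coeffE, coeffF, coeffG, QuadraticMap.polar, h]
  ring

/-- In the standard basis the discriminant of `αβ` is `-(a₁b₂ - a₂b₁)² / 4`, which is nonzero for
independent covectors. -/
lemma exists_polar_ne_zero {Q : QuadraticForm ℂ (ℂ × ℂ)} {α β : Module.Dual ℂ (ℂ × ℂ)}
    (hαβ : LinearIndependent ℂ ![α, β]) (hQ : ∀ v, Q v = α v * β v) :
    ∃ a b, Q a * Q b - (QuadraticMap.polar Q a b / 2) ^ 2 ≠ 0 := by
  refine ⟨(1, 0), (0, 1), fun h => ?_⟩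
  simp only [QuadraticMap.polar, hQ, map_add] at h
  set a₁ := α (1, 0)
  set a₂ := α (0, 1)
  set b₁ := β (1, 0)
  set b₂ := β (0, 1)
  have hdet : a₁ * b₂ - a₂ * b₁ = 0 := by
    have : (a₁ * b₂ - a₂ * b₁) ^ 2 = 0 := by linear_combination -4 * h
    exact pow_eq_zero_iff two_ne_zero |>.1 this
  rw [LinearIndependent.pair_iff] at hαβ
  have hzero : ∀ γ : Module.Dual ℂ (ℂ × ℂ), γ (1, 0) = 0 → γ (0, 1) = 0 → γ = 0 := by
    intro γ h1 h2
    ext <;> simp [h1, h2]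
  have h1 := hαβ b₁ (-a₁) (hzero _ (by simp [a₁, b₁]; ring)
    (by simp only [LinearMap.add_apply, LinearMap.smul_apply, smul_eq_mul]
        linear_combination -hdet))
  have h2 := hαβ b₂ (-a₂) (hzero _
    (by simp only [LinearMap.add_apply, LinearMap.smul_apply, smul_eq_mul]
        linear_combination hdet) (by simp [a₂, b₂]; ring))
  have hα : α = 0 := hzero α (neg_eq_zero.1 h1.2) (neg_eq_zero.1 h2.2)
  exact one_ne_zero (hαβ 1 0 (by simp [hα])).1

lemma HasRankTwo.degenerate_ne_univ {w : SymmetricTwoDifferential X} (hw : HasRankTwo w) :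
    {x | ¬ NondegenerateAt w.toField x} ≠ univ := by
  obtain ⟨Z, -, hZ, h⟩ := hw
  obtain ⟨x, hx⟩ := (ne_univ_iff_exists_notMem Z).1 hZ
  obtain ⟨α, β, hαβ, hQ⟩ := h x hx
  refine (ne_univ_iff_exists_notMem _).2 ⟨x, fun h' => h' ?_⟩
  exact exists_polar_ne_zero (Q := w.toField x) hαβ hQ

/-- The curvature vanishes at points with a closed decomposition. -/
theorem HasClosedDecompositionAt.complexCurvature_eq_zero {w : SymmetricTwoDifferential X}
    {e : OpenPartialHomeomorph X (ℂ × ℂ)} (he : HolChart e) {z : ℂ × ℂ} (hz : z ∈ e.target)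
    (h : HasClosedDecompositionAt w (e.symm z)) : complexCurvature w e z = 0 := by
  obtain ⟨U, hU, hzU, μ₁, μ₂, h1, c1, h2, c2, hw⟩ := h
  have hev := eventually_mem_chart hU hz hzU
  refine brioschi_eq_zero (h1 e he z hz hzU).1 (h1 e he z hz hzU).2 (h2 e he z hz hzU).1
    (h2 e he z hz hzU).2 (hev.mono fun y hy => c1 e he y hy.1 hy.2)
    (hev.mono fun y hy => c2 e he y hy.1 hy.2) ?_ ?_ ?_
  · exact hev.mono fun y hy => hw _ hy.2 _
  · filter_upwards [hev] with y hy
    simp only [coeffF, QuadraticMap.polar, hw _ hy.2, map_add, coeff₁, coeff₂]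
    ring
  · exact hev.mono fun y hy => hw _ hy.2 _

end

section

variable {X : Type*} [TopologicalSpace X] [ChartedSpace (ℂ × ℂ) X] [IsManifold surfaceModel ω X]

lemma holChart_chartAt (x : X) : HolChart (chartAt (ℂ × ℂ) x) :=
  IsManifold.chart_mem_maximalAtlas x

/-! ### Analytic subsets -/

/-- Proper analytic subsets of connected manifolds have dense complements. -/
theorem IsAnalyticSubset.dense_compl [ConnectedSpace X] {Z : Set X} (hZ : IsAnalyticSubset Z)
    (hne : Z ≠ univ) : Dense Zᶜ := by
  rw [← interior_eq_empty_iff_dense_compl]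
  -- Near a point of the closure of the interior, the local equations vanish on a nonempty open
  -- subset of a ball, hence on the whole ball. So the interior is clopen, and connectedness
  -- decides.
  have hclosed : IsClosed (interior Z) := by
    refine isClosed_of_closure_subset fun x hx => ?_
    obtain ⟨U, hU, hxU, n, f, hf, hfZ⟩ := hZ x
    set e := chartAt (ℂ × ℂ) x with hedef
    have he : HolChart e := holChart_chartAt x
    have hxe : x ∈ e.source := mem_chart_source _ x
    have hxU' : e.symm (e x) ∈ U := by rwa [e.left_inv hxe]
    obtain ⟨r, hr, hB⟩ := Metric.eventually_nhds_iff_ball.1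
      (eventually_mem_chart hU (e.map_source hxe) hxU')
    have hVo : IsOpen (e.source ∩ e ⁻¹' Metric.ball (e x) r) :=
      e.isOpen_inter_preimage Metric.isOpen_ball
    obtain ⟨y, hyV, hyZ⟩ := mem_closure_iff.1 hx _ hVo ⟨hxe, Metric.mem_ball_self hr⟩
    have hzero : ∀ i, EqOn (fun z => f i (e.symm z)) 0 (Metric.ball (e x) r) := by
      intro i
      have han : AnalyticOnNhd ℂ (fun z => f i (e.symm z)) (Metric.ball (e x) r) :=
        fun z hz => (hf i).analyticAt hU he (hB z hz).1 (hB z hz).2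
      refine han.eqOn_zero_of_preconnected_of_eventuallyEq_zero
        (convex_ball _ _).isPreconnected hyV.2 ?_
      have hc : ContinuousAt e.symm (e y) := e.symm.continuousAt (e.map_source hyV.1)
      have : interior Z ∈ 𝓝 (e.symm (e y)) := by
        rw [e.left_inv hyV.1]
        exact isOpen_interior.mem_nhds hyZ
      filter_upwards [hc.eventually this, Metric.isOpen_ball.mem_nhds hyV.2] with z hz hzB
      exact (hfZ _ (hB z hzB).2).1 (interior_subset hz) i
    refine mem_interior.2 ⟨_, fun t ht => ?_, hVo, ⟨hxe, Metric.mem_ball_self hr⟩⟩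
    have htU := (hB _ ht.2).2
    rw [e.left_inv ht.1] at htU
    refine (hfZ t htU).2 fun i => ?_
    have := hzero i ht.2
    simpa [e.left_inv ht.1] using this
  rcases isClopen_iff.1 ⟨hclosed, isOpen_interior⟩ with h | h
  · exact h
  · exact absurd (interior_eq_univ.1 h) hne

lemma isAnalyticSubset_degenerate (w : SymmetricTwoDifferential X) :
    IsAnalyticSubset {x | ¬ NondegenerateAt w.toField x} := by
  intro x
  have he : HolChart (chartAt (ℂ × ℂ) x) := holChart_chartAt x
  refine ⟨(chartAt (ℂ × ℂ) x).source, (chartAt (ℂ × ℂ) x).open_source, mem_chart_source _ x, 1,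
    fun _ y => discr w.toField (chartAt (ℂ × ℂ) x) (chartAt (ℂ × ℂ) x y), fun _ => ?_, ?_⟩
  · refine ContMDiffOn.mono (he.holFunOn_comp (V := (chartAt (ℂ × ℂ) x).target) ?_)
      fun y hy => ⟨hy, (chartAt (ℂ × ℂ) x).map_source hy⟩
    exact fun z hz => w.holomorphic.analyticAt_discr he hz (mem_univ _)
  · intro y hy
    rw [mem_ofPred_eq, ← he.discr_apply_ne_zero_iff w.toField hy]
    simp

end

end ClosedDiff
end

noncomputable section

namespace ClosedDiff

open Set

/-! ### Curvature, closed decompositions and the core discriminant -/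

section

variable {X : Type*} [TopologicalSpace X] [ChartedSpace (ℂ × ℂ) X]

lemma SymmetricTwoDifferential.analyticAt_coeff (w : SymmetricTwoDifferential X)
    {e : OpenPartialHomeomorph X (ℂ × ℂ)} (he : HolChart e) {z : ℂ × ℂ} (hz : z ∈ e.target) :
    AnalyticAt ℂ (coeffE w.toField e) z ∧ AnalyticAt ℂ (coeffF w.toField e) z ∧
      AnalyticAt ℂ (coeffG w.toField e) z :=
  w.holomorphic e he z hz (mem_univ _)

/-- The curvature is continuous outside the discriminant locus. -/
lemma continuousAt_complexCurvature (w : SymmetricTwoDifferential X)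
    {e : OpenPartialHomeomorph X (ℂ × ℂ)} (he : HolChart e) {z : ℂ × ℂ} (hz : z ∈ e.target)
    (hd : discr w.toField e z ≠ 0) : ContinuousAt (complexCurvature w e) z := by
  obtain ⟨hE, hF, hG⟩ := w.analyticAt_coeff he hz
  have cE := hE.continuousAt
  have cF := hF.continuousAt
  have cG := hG.continuousAt
  have cE1 := (analyticAt_partial₁ hE).continuousAt
  have cE2 := (analyticAt_partial₂ hE).continuousAt
  have cF1 := (analyticAt_partial₁ hF).continuousAt
  have cF2 := (analyticAt_partial₂ hF).continuousAt
  have cG1 := (analyticAt_partial₁ hG).continuousAt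
  have cG2 := (analyticAt_partial₂ hG).continuousAt
  have cE22 := (analyticAt_partial₂ (analyticAt_partial₂ hE)).continuousAt
  have cF12 := (analyticAt_partial₂ (analyticAt_partial₁ hF)).continuousAt
  have cG11 := (analyticAt_partial₁ (analyticAt_partial₁ hG)).continuousAt
  have hd' : (coeffE w.toField e z * coeffG w.toField e z - coeffF w.toField e z ^ 2) ^ 2 ≠ 0 :=
    pow_ne_zero 2 hd
  have heq : complexCurvature w e =
      fun z => brioschi (coeffE w.toField e) (coeffF w.toField e) (coeffG w.toField e) z := rfl
  rw [heq]
  simp only [brioschi, Matrix.det_fin_three, Matrix.of_apply, Matrix.cons_val',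
    Matrix.cons_val_zero, Matrix.cons_val_one, Matrix.cons_val]
  refine ContinuousAt.div₀ ?_ (by fun_prop) hd'
  fun_prop

/-- A differential which is `2F dz₁dz₂` with `F = A(z₁)B(z₂)` on a polydisc in a chart has a
closed decomposition there. -/
lemma hasClosedDecompositionAt_of_chart {w : SymmetricTwoDifferential X}
    {e : OpenPartialHomeomorph X (ℂ × ℂ)} (he : HolChart e) {x : X} (hx : x ∈ e.source) {r : ℝ}
    (hr : 0 < r) (hB : Metric.ball (e x) r ⊆ e.target)
    (hE : ∀ z ∈ Metric.ball (e x) r, coeffE w.toField e z = 0)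
    (hG : ∀ z ∈ Metric.ball (e x) r, coeffG w.toField e z = 0) {A B : ℂ → ℂ}
    (hA : DifferentiableOn ℂ A (Metric.ball (e x).1 r))
    (hB' : DifferentiableOn ℂ B (Metric.ball (e x).2 r))
    (hF : ∀ z ∈ Metric.ball (e x) r, coeffF w.toField e z = A z.1 * B z.2) :
    HasClosedDecompositionAt w x := by
  -- Primitives of `2A` and `B` on discs, so that `2AB dz₁dz₂ = da · db` with exact factors; the `2`
  -- is that of `2F dz₁dz₂`.
  obtain ⟨a, ha⟩ := (hA.const_mul 2).isExactOn_ball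
  obtain ⟨b, hb⟩ := hB'.isExactOn_ball
  have hmem : ∀ z ∈ Metric.ball (e x) r,
      z.1 ∈ Metric.ball (e x).1 r ∧ z.2 ∈ Metric.ball (e x).2 r := by
    intro z hz
    rw [← ball_prod_same] at hz
    exact hz
  have haa : AnalyticOnNhd ℂ (fun z : ℂ × ℂ => a z.1) (Metric.ball (e x) r) := by
    intro z hz
    have h1 : AnalyticAt ℂ a z.1 := DifferentiableOn.analyticAt (s := Metric.ball (e x).1 r)
      (fun t ht => (ha t ht).differentiableAt.differentiableWithinAt)
      (Metric.isOpen_ball.mem_nhds (hmem z hz).1)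
    exact AnalyticAt.comp_of_eq (g := a) h1 analyticAt_fst rfl
  have hba : AnalyticOnNhd ℂ (fun z : ℂ × ℂ => b z.2) (Metric.ball (e x) r) := by
    intro z hz
    have h1 : AnalyticAt ℂ b z.2 := DifferentiableOn.analyticAt (s := Metric.ball (e x).2 r)
      (fun t ht => (hb t ht).differentiableAt.differentiableWithinAt)
      (Metric.isOpen_ball.mem_nhds (hmem z hz).2)
    exact AnalyticAt.comp_of_eq (g := b) h1 analyticAt_snd rfl
  set U : Set X := e.source ∩ e ⁻¹' Metric.ball (e x) r with hUdef
  have hU : IsOpen U := e.isOpen_inter_preimage Metric.isOpen_ball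
  have h1 := he.holFunOn_comp haa
  have h2 := he.holFunOn_comp hba
  refine ⟨U, hU, ⟨hx, Metric.mem_ball_self hr⟩, differential fun y => a (e y).1,
    differential fun y => b (e y).2, holFormOn_differential h1 hU, closedFormOn_differential h1 hU,
    holFormOn_differential h2 hU, closedFormOn_differential h2 hU, ?_⟩
  have key : ∀ z ∈ Metric.ball (e x) r, ∀ t, w.toField (e.symm z) t
      = differential (fun y => a (e y).1) (e.symm z) t
        * differential (fun y => b (e y).2) (e.symm z) t := by
    intro z hz t
    have hzt := hB hz
    have hzU : e.symm z ∈ U :=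
      ⟨e.map_target hzt, by rwa [mem_preimage, e.right_inv hzt]⟩
    obtain ⟨v, rfl⟩ := he.chartVec_surjective hzt t
    have hev : ∀ᶠ y in 𝓝 z, e (e.symm y) = y :=
      (e.open_target.eventually_mem hzt).mono fun y hy => e.right_inv hy
    have d1 : HasFDerivAt (fun y => a (e (e.symm y)).1)
        ((2 * A z.1) • ContinuousLinearMap.fst ℂ ℂ ℂ) z := by
      have := (ha z.1 (hmem z hz).1).comp_hasFDerivAt z (hasFDerivAt_fst (𝕜 := ℂ) (p := z))
      exact this.congr_of_eventuallyEq (hev.mono fun y hy => by simp [hy])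
    have d2 : HasFDerivAt (fun y => b (e (e.symm y)).2)
        (B z.2 • ContinuousLinearMap.snd ℂ ℂ ℂ) z := by
      have := (hb z.2 (hmem z hz).2).comp_hasFDerivAt z (hasFDerivAt_snd (𝕜 := ℂ) (p := z))
      exact this.congr_of_eventuallyEq (hev.mono fun y hy => by simp [hy])
    rw [quad_chartVec, differential_chartVec h1 hU he hzt hzU,
      differential_chartVec h2 hU he hzt hzU, d1.fderiv, d2.fderiv, hE z hz, hG z hz, hF z hz]
    simp
    ring
  intro y hy t
  have h3 := key (e y) hy.2
  rw [e.left_inv hy.1] at h3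
  exact h3 t

end

section

variable {X : Type*} [TopologicalSpace X] [ChartedSpace (ℂ × ℂ) X] [IsManifold surfaceModel ω X]

/-- Points at which `w` is nondegenerate do not belong to the support of the core discriminant
divisor. -/
theorem NondegenerateAt.notMem_coreDiscrSupport {w : SymmetricTwoDifferential X} {x : X}
    (h : NondegenerateAt w.toField x) : x ∉ coreDiscrSupport w := by
  intro hx
  set e := chartAt (ℂ × ℂ) x with hedef
  have he : HolChart e := holChart_chartAt x
  have hxe : x ∈ e.source := mem_chart_source _ x
  have hd := (he.discr_apply_ne_zero_iff w.toField hxe).2 h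
  -- At such a point `1` is an equation of the divisor of zeros, so the discriminant itself is a
  -- core equation. Indeed a divisor `h'` of `w` contributes `h'²` to the discriminant, and is
  -- therefore a unit.
  refine hd (hx (fun y => discr w.toField e (e y)) ⟨?_, fun _ => 1, ⟨?_, ?_⟩, e, he, hxe, ?_⟩)
  · have han : AnalyticOnNhd ℂ (discr w.toField e) e.target :=
      fun z hz => w.holomorphic.analyticAt_discr he hz (mem_univ _)
    exact (he.holFunOn_comp han).contMDiffAt
      ((e.isOpen_inter_preimage e.open_target).mem_nhds ⟨hxe, e.map_source hxe⟩)
  · exact ⟨univ, isOpen_univ, mem_univ _, contMDiffOn_const, w.toField, w.holomorphic,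
      fun y _ v => (one_mul _).symm⟩
  · rintro h' ⟨U, hU, hxU, hh', q, hq, hwq⟩
    have hne : h' x ≠ 0 := by
      intro h0
      apply hd
      rw [discr_of_eq_mul (q := q) (c := h' x)]
      · simp [h0]
      · have h1 := hwq x hxU
        rw [e.left_inv hxe]
        exact h1
    have hcont : ContMDiffAt surfaceModel 𝓘(ℂ, ℂ) ω h' x := hh'.contMDiffAt (hU.mem_nhds hxU)
    refine ⟨fun y => (h' y)⁻¹, ?_, ?_⟩
    · exact ((contDiffAt_inv ℂ hne).contMDiffAt (n := ω)).comp x hcont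
    · filter_upwards [hcont.continuousAt.eventually_ne hne] with y hy
      exact (inv_mul_cancel₀ hy).symm
  · exact Filter.Eventually.of_forall fun y => by simp

/-- Closed differentials have zero curvature. -/
theorem IsClosedDifferential.complexCurvatureVanishes [ConnectedSpace X]
    {w : SymmetricTwoDifferential X} (h : IsClosedDifferential w) : ComplexCurvatureVanishes w := by
  obtain ⟨Z, hZ, hne, hdec⟩ := h
  intro e he z hz hd
  have hfreq := frequently_mem_chart_of_dense (hZ.dense_compl hne) hz
  refine tendsto_nhds_unique_of_frequently_eq (continuousAt_complexCurvature w he hz hd)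
    (tendsto_const_nhds (x := (0 : ℂ))) (hfreq.mono fun y hy => ?_)
  exact (hdec _ hy.2).complexCurvature_eq_zero he hy.1

/-- Differentials with zero curvature have closed decompositions outside the support of the core
discriminant divisor. -/
theorem ComplexCurvatureVanishes.isFirstKindOn [ConnectedSpace X]
    {w : SymmetricTwoDifferential X} (hw : HasRankTwo w) (hK : ComplexCurvatureVanishes w) :
    IsFirstKindOn w (coreDiscrSupport w)ᶜ := by
  have hdense : Dense {x | NondegenerateAt w.toField x} := by
    have := (isAnalyticSubset_degenerate w).dense_compl hw.degenerate_ne_univ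
    convert this using 1
    ext x
    simp
  intro x hx
  simp only [coreDiscrSupport, mem_compl_iff, mem_ofPred_eq, not_forall] at hx
  obtain ⟨δ, ⟨hδ, h, ⟨⟨U, hU, hxU, hhol, q, hq, hwq⟩, -⟩, e, he, hxe, hdisc⟩, hδx⟩ := hx
  set p := e x with hp
  have hpt : p ∈ e.target := e.map_source hxe
  have hpx : e.symm p = x := e.left_inv hxe
  have hpU : e.symm p ∈ U := by rwa [hpx]
  -- From `discr w = discr q · h²` and `discr w = δ h²`, cancel `h²` at nondegenerate points of `w`.
  -- These are dense, so continuity gives equality at `p` even if `h x = 0`.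
  have hqd : discr q e p = δ x := by
    have c1 : Filter.Tendsto (discr q e) (𝓝 p) (𝓝 (discr q e p)) :=
      (hq.analyticAt_discr he hpt hpU).continuousAt
    have hs : Filter.Tendsto e.symm (𝓝 p) (𝓝 x) := by
      have := e.symm.continuousAt hpt
      rwa [ContinuousAt, hpx] at this
    have c2 : Filter.Tendsto (fun z => δ (e.symm z)) (𝓝 p) (𝓝 (δ x)) :=
      hδ.continuousAt.tendsto.comp hs
    refine tendsto_nhds_unique_of_frequently_eq c1 c2 ?_
    refine ((frequently_mem_chart_of_dense hdense hpt).and_eventually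
      ((eventually_mem_chart hU hpt hpU).and (hs.eventually hdisc))).mono ?_
    rintro z ⟨⟨hz, hzn⟩, ⟨-, hzU⟩, hzd⟩
    rw [e.right_inv hz] at hzd
    have h1 := (he.discr_ne_zero_iff w.toField hz).2 hzn
    have h2 := discr_of_eq_mul (e := e) (hwq _ hzU)
    have h3 : h (e.symm z) ^ 2 ≠ 0 := by
      intro h0
      rw [h0, mul_zero] at h2
      exact h1 h2
    exact mul_right_cancel₀ h3 (h2.symm.trans hzd)
  obtain ⟨hE, hF, hG⟩ := hq e he p hpt hpU
  -- Null coordinates are taken for `q`, since `w` may degenerate at `x`. Being a multiple of `q`,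
  -- `w` has the same isotropic coordinate directions.
  obtain ⟨φ, hpφ, hφ, hφ', hnull⟩ := exists_null_coordinates hE hF hG
    (by rw [← discr, hqd]; exact hδx)
  set e' := e.trans φ with he'def
  have he' : HolChart e' := he.trans hφ hφ'
  have hxe' : x ∈ e'.source := by
    rw [he'def, OpenPartialHomeomorph.trans_source]
    exact ⟨hxe, hpφ⟩
  have hpx' : e'.symm (e' x) ∈ U := by rwa [e'.left_inv hxe']
  obtain ⟨r, hr, hB⟩ := Metric.eventually_nhds_iff_ball.1
    (eventually_mem_chart hU (e'.map_source hxe') hpx')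
  have hnull' : ∀ z ∈ Metric.ball (e' x) r, ∀ b : ℂ × ℂ, b = (1, 0) ∨ b = (0, 1) →
      w.toField (e'.symm z) (chartVec e' z b) = 0 := by
    intro z hz b hb
    have hz' := (hB z hz).1
    have hzφ : z ∈ φ.target := by
      rw [he'def, OpenPartialHomeomorph.trans_target] at hz'
      exact hz'.1
    rw [hwq _ (hB z hz).2, he.chartVec_trans hz' (hφ' z hzφ).differentiableAt]
    have h1 := quad_chartVec q e (φ.symm z) (fderiv ℂ φ.symm z b)
    rw [hnull z hzφ b hb] at h1
    exact mul_eq_zero_of_right _ h1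
  have hE0 : ∀ z ∈ Metric.ball (e' x) r, coeffE w.toField e' z = 0 :=
    fun z hz => hnull' z hz _ (Or.inl rfl)
  have hG0 : ∀ z ∈ Metric.ball (e' x) r, coeffG w.toField e' z = 0 :=
    fun z hz => hnull' z hz _ (Or.inr rfl)
  have hdF : ∀ z ∈ Metric.ball (e' x) r,
      discr w.toField e' z = - coeffF w.toField e' z ^ 2 := by
    intro z hz
    rw [discr, hE0 z hz, zero_mul, zero_sub]
  -- The coefficient `F` of `w` may vanish at the centre of the ball, so the splitting starts from a
  -- nearby nondegenerate point.
  obtain ⟨z₀, ⟨hz₀t, hz₀n⟩, hz₀⟩ := ((frequently_mem_chart_of_dense hdense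
    (e'.map_source hxe')).and_eventually (Metric.ball_mem_nhds _ hr)).exists
  have hFz₀ : coeffF w.toField e' z₀ ≠ 0 := by
    intro h0
    have h1 := (he'.discr_ne_zero_iff w.toField hz₀t).2 hz₀n
    rw [hdF z₀ hz₀, h0] at h1
    simp at h1
  obtain ⟨A, B, hA, hB', hAB⟩ := exists_eq_mul_of_partial (c := coeffF w.toField e')
    (fun z hz => (w.analyticAt_coeff he' (hB z hz).1).2.1) hz₀ hFz₀ (by
      intro z hz hFz
      have hev := Metric.isOpen_ball.eventually_mem hz
      refine brioschi_of_null (hev.mono hE0) (hev.mono hG0) hFz (hK e' he' z (hB z hz).1 ?_)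
      rw [hdF z hz]
      simpa using hFz)
  exact hasClosedDecompositionAt_of_chart he' hxe' hr (fun z hz => (hB z hz).1) hE0 hG0 hA hB' hAB

end

end ClosedDiff
end

theorem proposition2p1 {X : Type*} [TopologicalSpace X] [T2Space X] [ConnectedSpace X]
    [ChartedSpace (ℂ × ℂ) X] [IsManifold ClosedDiff.surfaceModel ω X]
    (w : ClosedDiff.SymmetricTwoDifferential X) (hw : ClosedDiff.HasRankTwo w) :
    (ClosedDiff.IsClosedDifferential w ↔ ClosedDiff.ComplexCurvatureVanishes w) ∧
    (ClosedDiff.ComplexCurvatureVanishes w ↔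
      ClosedDiff.IsFirstKindOn w (ClosedDiff.coreDiscrSupport w)ᶜ) := by
  refine ⟨⟨fun h => h.complexCurvatureVanishes, fun hK => ?_⟩, fun hK => hK.isFirstKindOn hw,
    fun h e he z hz hd => ?_⟩
  -- The degeneracy locus is the proper analytic subset to discard: outside it, points avoid the
  -- core discriminant.
  · refine ⟨_, ClosedDiff.isAnalyticSubset_degenerate w, hw.degenerate_ne_univ, fun x hx => ?_⟩
    exact hK.isFirstKindOn hw x
      (ClosedDiff.NondegenerateAt.notMem_coreDiscrSupport (by simpa using hx))
  · have hn := (he.discr_ne_zero_iff w.toField hz).1 hd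
    exact (h _ hn.notMem_coreDiscrSupport).complexCurvature_eq_zero he hz
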